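/- Let $G$ be a connected compact metric graph, i.e. a connected finite graph with vertex set $V$ and edge set $E$, without loops and without multiple edges, in which every edge $e$ has a finite length $\ell_e>0$ and is identified with $[0,\ell_e]$, the points $0$ and $\ell_e$ being its initial and terminal vertices. A function $u$ on $G$ is a family $([u]_e)_{e\in E}$ of functions on $(0,\ell_e)$, and $\int_G u=\sum_e\int_0^{\ell_e}[u]_e$. For each $e\in E$ let $1<p_e<\infty$ and let $\gamma_e:\mathbb R\to\mathbb R$ be continuous and (strictly) increasing with $\gamma_e(\mathbb R)=\mathbb R$ and $\gamma_e(0)=0$; write $v=\overline\gamma(u)$ if $[v]_e=\gamma_e([u]_e)$ a.e. for all $e$. For a family $\overline q=(q_e)$ of exponents $q_e\ge 1$ let $\mathcal W^{1,\overline q}(G)$ be the space of functions $u$ on $G$ with $[u]_e\in W^{1,q_e}(0,\ell_e)$ for all $e$ that are continuous on the graph (the values at a vertex $a$ of the continuous representatives of $[u]_e$, for all edges $e$ at $a$, coincide; the common value is $u(a)$), with the norm $\sum_e(\|[u]_e\|_{L^{q_e}}^{q_e}+\|[u]_e'\|_{L^{q_e}}^{q_e})^{1/q_e}$; put $\mathcal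 W^{1,1}(G)=\mathcal W^{1,\overline q}(G)$ for $q_e\equiv1$. Let $L^{\overline p}(0,T;\mathcal W^{1,\overline p}(G))$ be the space of those $h\in L^1(0,T;\mathcal W^{1,\overline p}(G))$ with $[h]_e\in L^{p_e}(0,T;W^{1,p_e}(0,\ell_e))$ for all $e$. Let $v_0\in L^1(G)$, $f\in L^1_{loc}([0,\infty);L^1(G))$ and $\omega\in L^1_{loc}([0,\infty);L^1(V))$, where $L^1(V)=\mathbb R^V$ with the $1$-norm. A *weak solution* of the evolution problem $\partial_t v-\Delta_{\overline p}u=f$, $v=\overline\gamma(u)$, $u$ continuous, with flux $\omega_a(t)$ at each vertex $a$ and $v(0)=v_0$, is a function $v:[0,\infty)\to L^1(G)$ with $v(0)=v_0$ such that for every $T>0$ one has $v\in C([0,T];L^1(G))$ and there is $u\in L^{\overline p}(0,T;\mathcal W^{1,\overline p}(G))$ with $v(t)=\overline\gamma(u(t))$ for a.e. $t\in(0,T)$ and $$-\int_0^T\!\!\int_G v(t)\,\partial_t\psi(t)\,dx\,dt+\sum_{e\in E}\int_0^T\!\!\int_0^{\ell_e}|[u(t)]_e'|^{p_e-2}[u(t)]_e'[\psi(t)]_e'\,dx\,dt=\int_0^T\!\!\int_G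 f(t)\psi(t)\,dx\,dt+\sum_{a\in V}\int_0^T\omega_a(t)\psi(t)(a)\,dt$$ for all $\psi\in W^{1,1}(0,T;\mathcal W^{1,1}(G))\cap L^{\overline p}(0,T;\mathcal W^{1,\overline p}(G))$ with $\psi(0)=\psi(T)=0$. Let $X=L^1(G)\times L^1(V)$ with the norm $\|(v,w)\|=\int_G|v|+\sum_{a\in V}|w_a|$, and let $\mathcal A\subset X\times X$ be the operator consisting of all pairs $((z,0),(\tilde v,\tilde\omega))$ such that $z$ is a weak solution of the elliptic problem with data $z+\tilde v$ and $\tilde\omega$, i.e. there is $\tilde u\in\mathcal W^{1,\overline p}(G)$ with $z=\overline\gamma(\tilde u)$ a.e. and $$\int_G z\varphi\,dx+\sum_{e\in E}\int_0^{\ell_e}|[\tilde u]_e'|^{p_e-2}[\tilde u]_e'[\varphi]_e'\,dx=\int_G(z+\tilde v)\varphi\,dx+\sum_{a\in V}\tilde\omega_a\varphi(a)\qquad\text{for all }\varphi\in\mathcal W^{1,\overline p}(G).$$ **Theorem.** If $v$ is a weak solution of the evolution problem, then for every $T>0$ the function $W=(v,0)$ is an integral solution (in the sense of Bénilan) on $[0,T]$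 of the abstract Cauchy problem $W'+\mathcal A W\ni(f,\omega)$, $W(0)=(v_0,0)$, in $X$. That is: $W\in C([0,T];X)$, $W(0)=(v_0,0)$, and for all $(x,y)\in\mathcal A$ the inequality $$\frac{d}{dt}\|W(t)-x\|\le[\,W(t)-x,\,(f(t),\omega(t))-y\,]$$ holds in $\mathcal D'(]0,T[)$ (tested with nonnegative functions of $\mathcal D(]0,T[)$), its right-hand side being locally integrable in $]0,T[$, where $[x,y]=\lim_{\lambda\downarrow0}(\|x+\lambda y\|-\|x\|)/\lambda$. -/

import Mathlib

open MeasureTheory Set Filter Topology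
open scoped ENNReal

set_option linter.unusedSectionVars false

noncomputable section

/-! ### Scalar test functions and vector-valued weak derivatives -/

/-- `φ ∈ 𝒟(]a, b[)`. -/
structure IsScalarTest (a b : ℝ) (φ : ℝ → ℝ) : Prop where
  smooth : ContDiff ℝ ((⊤ : ℕ∞) : WithTop ℕ∞) φ
  compact : HasCompactSupport φ
  support : tsupport φ ⊆ Ioo a b

/-- `g` is the weak derivative of `u` on `]a, b[`. This is only used for functions that are
integrable on `]a, b[`, with values in a Banach space. -/
def HasWeakDeriv {F : Type*} [NormedAddCommGroup F] [NormedSpace ℝ F] [CompleteSpace F]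
    (a b : ℝ) (u g : ℝ → F) : Prop :=
  ∀ φ : ℝ → ℝ, IsScalarTest a b φ →
    ∫ x in Ioo a b, deriv φ x • u x = - ∫ x in Ioo a b, φ x • g x

/-! ### Integral solutions of abstract Cauchy problems -/

section Abstract

variable {X : Type*} [NormedAddCommGroup X] [NormedSpace ℝ X]

/-- The bracket `[x, y] = lim_{λ ↓ 0} (‖x + λ y‖ - ‖x‖) / λ`. -/
def normBracket (x y : X) : ℝ :=
  limUnder (𝓝[>] (0 : ℝ)) fun r : ℝ => (‖x + r • y‖ - ‖x‖) / r

/-- The limit that defines the bracket always exists. -/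
theorem tendsto_normBracket (x y : X) :
    Tendsto (fun r : ℝ => (‖x + r • y‖ - ‖x‖) / r) (𝓝[>] (0 : ℝ)) (𝓝 (normBracket x y)) := by
  have hc : ConvexOn ℝ univ fun r : ℝ => ‖x + r • y‖ := by
    refine ⟨convex_univ, fun r _ s _ a b ha hb hab => ?_⟩
    have h : x + (a • r + b • s) • y = a • (x + r • y) + b • (x + s • y) := by
      calc x + (a • r + b • s) • y = (a + b) • x + (a • r + b • s) • y := by rw [hab, one_smul]
        _ = a • (x + r • y) + b • (x + s • y) := by
          simp only [smul_eq_mul, add_smul, smul_add, mul_smul]; abel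
    calc ‖x + (a • r + b • s) • y‖ ≤ ‖a • (x + r • y)‖ + ‖b • (x + s • y)‖ := by
          rw [h]; exact norm_add_le _ _
      _ = a • ‖x + r • y‖ + b • ‖x + s • y‖ := by
          rw [norm_smul, norm_smul, Real.norm_of_nonneg ha, Real.norm_of_nonneg hb]; rfl
  have hd := hc.hasDerivWithinAt_rightDeriv_of_mem_interior (x := 0) (by simp)
  rw [hasDerivWithinAt_iff_tendsto_slope' (by simp)] at hd
  refine tendsto_nhds_limUnder ⟨_, hd.congr fun r => ?_⟩
  simp [slope_def_field]

/-- `w` is an integral solution on `[0, T]` of `w' + A w ∋ F`, `w(0) = w₀`, for the (multivalued)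
operator with graph `A`: the inequality `d/dt ‖w(t) - x‖ ≤ [w(t) - x, F(t) - y]` holds in
`𝒟'(]0, T[)` for all `(x, y) ∈ A`, its right-hand side being locally integrable in `]0, T[`. -/
structure IsIntegralSolution (A : Set (X × X)) (F : ℝ → X) (w₀ : X) (T : ℝ) (w : ℝ → X) :
    Prop where
  continuousOn : ContinuousOn w (Icc 0 T)
  initial : w 0 = w₀
  locallyIntegrable : ∀ x y : X, (x, y) ∈ A →
    LocallyIntegrableOn (fun t => normBracket (w t - x) (F t - y)) (Ioo 0 T)
  inequality : ∀ x y : X, (x, y) ∈ A → ∀ ξ : ℝ → ℝ, IsScalarTest 0 T ξ → (∀ t, 0 ≤ ξ t) →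
    - ∫ t in Ioo 0 T, ‖w t - x‖ * deriv ξ t
      ≤ ∫ t in Ioo 0 T, normBracket (w t - x) (F t - y) * ξ t

end Abstract

/-! ### Compact metric graphs -/

/-- A compact metric graph with (finite) vertex set `V` and edge set `E`, without loops and without
multiple edges: every edge `e` has a finite length and is identified with `[0, length e]`,
the point `0` being its initial and the point `length e` its terminal vertex. -/
structure CompactMetricGraph (V E : Type*) [Fintype V] [Fintype E] where
  init : E → V
  term : E → V
  length : E → ℝ
  length_pos : ∀ e, 0 < length e
  no_loop : ∀ e, init e ≠ term e
  no_multiple : ∀ e e', s(init e, term e) = s(init e', term e') → e = e'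

namespace CompactMetricGraph

variable {V E : Type*} [Fintype V] [Fintype E] (G : CompactMetricGraph V E)

/-- Any two vertices are joined by a path. -/
def Connected : Prop :=
  (SimpleGraph.fromRel fun a b : V => ∃ e, G.init e = a ∧ G.term e = b).Connected

/-- Lebesgue measure on the edge `e`, that is, on `]0, ℓ_e[`. -/
abbrev edgeMeasure (e : E) : Measure ℝ := volume.restrict (Ioo 0 (G.length e))

/-- `L¹(G)`, with the norm `∑ₑ ‖[u]ₑ‖_{L¹(0, ℓₑ)}`. -/
abbrev L1 : Type _ := PiLp 1 fun e : E => Lp ℝ 1 (G.edgeMeasure e)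

/-- `L¹(V(G))`: the functions `V → ℝ`, with the `1`-norm. -/
abbrev VertexL1 (_G : CompactMetricGraph V E) : Type _ := PiLp 1 fun _ : V => ℝ

/-- `X = L¹(G) × L¹(V(G))`, with the sum of the two norms. -/
abbrev StateSpace : Type _ := WithLp 1 (G.L1 × G.VertexL1)

section Sobolev

variable (q : E → ℝ≥0∞) [∀ e, Fact (1 ≤ q e)]

/-- Pairs `(u, g)` of functions on the graph with `[u]ₑ, [g]ₑ ∈ L^{qₑ}(0, ℓₑ)`, with the norm
`∑ₑ (‖[u]ₑ‖^{qₑ} + ‖[g]ₑ‖^{qₑ})^{1/qₑ}`. -/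
abbrev PairSpace : Type _ :=
  PiLp 1 fun e : E => WithLp (q e) (Lp ℝ (q e) (G.edgeMeasure e) × Lp ℝ (q e) (G.edgeMeasure e))

variable {G q}

/-- The first function of a pair, on the edge `e`. -/
def PairSpace.fn (u : G.PairSpace q) (e : E) : ℝ → ℝ := (u e).fst

/-- The second function of a pair, on the edge `e`. -/
def PairSpace.der (u : G.PairSpace q) (e : E) : ℝ → ℝ := (u e).snd

/-- Every `[u]ₑ` has a representative that is continuous on `[0, ℓₑ]`, with the value `c v` at each
end of `e`, where `v` is the vertex at that end. So `u ∈ C(V(G))`, and `u(v) = c v`. -/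
def HasVertexValues (u : G.PairSpace q) (c : V → ℝ) : Prop :=
  ∀ e, ∃ r : ℝ → ℝ, ContinuousOn r (Icc 0 (G.length e)) ∧ u.fn e =ᵐ[G.edgeMeasure e] r ∧
    r 0 = c (G.init e) ∧ r (G.length e) = c (G.term e)

theorem PairSpace.integrable_fn (u : G.PairSpace q) (e : E) :
    Integrable (u.fn e) (G.edgeMeasure e) :=
  (Lp.memLp (u e).fst).integrable Fact.out

theorem PairSpace.integrable_der (u : G.PairSpace q) (e : E) :
    Integrable (u.der e) (G.edgeMeasure e) :=
  (Lp.memLp (u e).snd).integrable Fact.out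

theorem PairSpace.fn_add (u w : G.PairSpace q) (e : E) :
    (u + w).fn e =ᵐ[G.edgeMeasure e] fun x => u.fn e x + w.fn e x :=
  Lp.coeFn_add (u e).fst (w e).fst

theorem PairSpace.der_add (u w : G.PairSpace q) (e : E) :
    (u + w).der e =ᵐ[G.edgeMeasure e] fun x => u.der e x + w.der e x :=
  Lp.coeFn_add (u e).snd (w e).snd

theorem PairSpace.fn_smul (a : ℝ) (u : G.PairSpace q) (e : E) :
    (a • u).fn e =ᵐ[G.edgeMeasure e] fun x => a * u.fn e x :=
  Lp.coeFn_smul a (u e).fst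

theorem PairSpace.der_smul (a : ℝ) (u : G.PairSpace q) (e : E) :
    (a • u).der e =ᵐ[G.edgeMeasure e] fun x => a * u.der e x :=
  Lp.coeFn_smul a (u e).snd

theorem PairSpace.fn_zero (e : E) :
    (0 : G.PairSpace q).fn e =ᵐ[G.edgeMeasure e] fun _ => 0 :=
  Lp.coeFn_zero ℝ (q e) (G.edgeMeasure e)

theorem PairSpace.der_zero (e : E) :
    (0 : G.PairSpace q).der e =ᵐ[G.edgeMeasure e] fun _ => 0 :=
  Lp.coeFn_zero ℝ (q e) (G.edgeMeasure e)

end Sobolev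

theorem _root_.IsScalarTest.integrable_mul {a b : ℝ} {φ : ℝ → ℝ} (h : IsScalarTest a b φ)
    {μ : Measure ℝ} {u : ℝ → ℝ} (hu : Integrable u μ) :
    Integrable (fun x => φ x * u x) μ ∧ Integrable (fun x => deriv φ x * u x) μ := by
  obtain ⟨C, hC⟩ := h.compact.exists_bound_of_continuous h.smooth.continuous
  have hd : Continuous (deriv φ) := h.smooth.continuous_deriv (by simp)
  obtain ⟨D, hD⟩ := h.compact.deriv.exists_bound_of_continuous hd
  exact ⟨hu.bdd_mul h.smooth.continuous.aestronglyMeasurable (ae_of_all _ hC),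
    hu.bdd_mul hd.aestronglyMeasurable (ae_of_all _ hD)⟩

variable (q : E → ℝ≥0∞) [∀ e, Fact (1 ≤ q e)]

/-- The space `𝒲̃^{1,q}(G)` of the functions `u` on the graph with `[u]ₑ ∈ W^{1,qₑ}(0, ℓₑ)` for every
edge `e`; such a function is stored together with its weak derivative, so that the norm is the
Sobolev norm `∑ₑ (‖[u]ₑ‖^{qₑ} + ‖[u]ₑ'‖^{qₑ})^{1/qₑ}`. -/
def BrokenSobolev : Submodule ℝ (G.PairSpace q) where
  carrier := {u | ∀ e, HasWeakDeriv 0 (G.length e) (u.fn e) (u.der e)}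
  zero_mem' := by
    intro e φ hφ
    have h1 : ∫ x in Ioo 0 (G.length e), deriv φ x • (0 : G.PairSpace q).fn e x = 0 :=
      integral_eq_zero_of_ae (by
        filter_upwards [PairSpace.fn_zero (G := G) (q := q) e] with x hx; simp [hx])
    have h2 : ∫ x in Ioo 0 (G.length e), φ x • (0 : G.PairSpace q).der e x = 0 :=
      integral_eq_zero_of_ae (by
        filter_upwards [PairSpace.der_zero (G := G) (q := q) e] with x hx; simp [hx])
    rw [h1, h2, neg_zero]
  add_mem' := by
    intro u w hu hw e φ hφ
    have h1 := hu e φ hφ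
    have h2 := hw e φ hφ
    simp only [smul_eq_mul] at h1 h2 ⊢
    have h3 : ∫ x in Ioo 0 (G.length e), deriv φ x * (u + w).fn e x
        = ∫ x in Ioo 0 (G.length e), (deriv φ x * u.fn e x + deriv φ x * w.fn e x) :=
      integral_congr_ae (by filter_upwards [u.fn_add w e] with x hx; rw [hx, mul_add])
    have h4 : ∫ x in Ioo 0 (G.length e), φ x * (u + w).der e x
        = ∫ x in Ioo 0 (G.length e), (φ x * u.der e x + φ x * w.der e x) :=
      integral_congr_ae (by filter_upwards [u.der_add w e] with x hx; rw [hx, mul_add])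
    rw [h3, h4, integral_add (hφ.integrable_mul (u.integrable_fn e)).2
      (hφ.integrable_mul (w.integrable_fn e)).2,
      integral_add (hφ.integrable_mul (u.integrable_der e)).1
      (hφ.integrable_mul (w.integrable_der e)).1, h1, h2, neg_add]
  smul_mem' := by
    intro a u hu e φ hφ
    have h1 := hu e φ hφ
    simp only [smul_eq_mul] at h1 ⊢
    have h3 : ∫ x in Ioo 0 (G.length e), deriv φ x * (a • u).fn e x
        = ∫ x in Ioo 0 (G.length e), a * (deriv φ x * u.fn e x) :=
      integral_congr_ae (by filter_upwards [u.fn_smul a e] with x hx; rw [hx]; ring)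
    have h4 : ∫ x in Ioo 0 (G.length e), φ x * (a • u).der e x
        = ∫ x in Ioo 0 (G.length e), a * (φ x * u.der e x) :=
      integral_congr_ae (by filter_upwards [u.der_smul a e] with x hx; rw [hx]; ring)
    rw [h3, h4, integral_const_mul, integral_const_mul, h1, mul_neg]

/-- The space `𝒲^{1,q}(G) = 𝒲̃^{1,q}(G) ∩ C(V(G))`, with the Sobolev norm. -/
def Sobolev : Submodule ℝ (G.PairSpace q) where
  carrier := {u | u ∈ G.BrokenSobolev q ∧ ∃ c : V → ℝ, HasVertexValues u c}
  zero_mem' := ⟨zero_mem _, 0, fun e =>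
    ⟨fun _ => 0, continuousOn_const, PairSpace.fn_zero e, rfl, rfl⟩⟩
  add_mem' := by
    rintro u w ⟨hu, c, hc⟩ ⟨hw, d, hd⟩
    refine ⟨add_mem hu hw, c + d, fun e => ?_⟩
    obtain ⟨r, hr, hr1, hr2, hr3⟩ := hc e
    obtain ⟨s, hs, hs1, hs2, hs3⟩ := hd e
    refine ⟨fun x => r x + s x, hr.add hs, ?_, by simp [hr2, hs2], by simp [hr3, hs3]⟩
    filter_upwards [u.fn_add w e, hr1, hs1] with x h1 h2 h3
    rw [h1, h2, h3]
  smul_mem' := by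
    rintro a u ⟨hu, c, hc⟩
    refine ⟨Submodule.smul_mem _ a hu, a • c, fun e => ?_⟩
    obtain ⟨r, hr, hr1, hr2, hr3⟩ := hc e
    refine ⟨fun x => a * r x, continuousOn_const.mul hr, ?_, by simp [hr2], by simp [hr3]⟩
    filter_upwards [u.fn_smul a e, hr1] with x h1 h2
    rw [h1, h2]

variable {G q}

/-- `[u]ₑ`. -/
def Sobolev.fn (u : G.Sobolev q) (e : E) : ℝ → ℝ := (u : G.PairSpace q).fn e

/-- `[u]ₑ'`. -/
def Sobolev.der (u : G.Sobolev q) (e : E) : ℝ → ℝ := (u : G.PairSpace q).der e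

/-- The value `u(v)` of `u ∈ 𝒲^{1,q}(G)` at the vertex `v`. -/
def Sobolev.vertexValue (u : G.Sobolev q) : V → ℝ := u.2.2.choose

theorem Sobolev.hasVertexValues (u : G.Sobolev q) :
    HasVertexValues (u : G.PairSpace q) (Sobolev.vertexValue u) := u.2.2.choose_spec

/-- The vertex values are determined by `u`. -/
theorem Sobolev.vertexValue_unique (u : G.Sobolev q) {c : V → ℝ}
    (hc : HasVertexValues (u : G.PairSpace q) c) (e : E) :
    Sobolev.vertexValue u (G.init e) = c (G.init e) ∧
      Sobolev.vertexValue u (G.term e) = c (G.term e) := by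
  obtain ⟨r, hr, hr1, hr2, hr3⟩ := hc e
  obtain ⟨s, hs, hs1, hs2, hs3⟩ := Sobolev.hasVertexValues u e
  have hl := G.length_pos e
  have h : EqOn s r (Icc 0 (G.length e)) :=
    Measure.eqOn_Icc_of_ae_eq (μ := volume) hl.ne (by
      rw [← restrict_Ioo_eq_restrict_Icc]
      exact hs1.symm.trans hr1) hs hr
  exact ⟨by rw [← hs2, ← hr2]; exact h (left_mem_Icc.2 hl.le),
    by rw [← hs3, ← hr3]; exact h (right_mem_Icc.2 hl.le)⟩

variable (G) (p : E → ℝ≥0∞) [∀ e, Fact (1 ≤ p e)]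

/-! ### The elliptic problem and the operator `𝒜` -/

/-- `∑ₑ ∫₀^{ℓₑ} |[u]ₑ'|^{pₑ-2} [u]ₑ' [φ]ₑ' dx`. -/
def pLaplaceForm (u φ : G.Sobolev p) : ℝ :=
  ∑ e, ∫ x in Ioo 0 (G.length e),
    |Sobolev.der u e x| ^ ((p e).toReal - 2) * Sobolev.der u e x * Sobolev.der φ e x

variable {p} in
/-- `∫_G v φ dx`, for `v ∈ L¹(G)` and `φ ∈ 𝒲^{1,p}(G)`. -/
def pairing (v : G.L1) (φ : G.Sobolev p) : ℝ :=
  ∑ e, ∫ x in Ioo 0 (G.length e), v e x * Sobolev.fn φ e x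

/-- `v` is a weak solution of the elliptic problem `v - Δ_p u = f`, `v = γ(u)`, with `u` continuous
and with the flux `ω_v` at each vertex `v`. -/
def IsEllipticWeakSolution (γ : E → ℝ → ℝ) (f : G.L1) (ω : G.VertexL1) (v : G.L1) : Prop :=
  ∃ u : G.Sobolev p, (∀ e, v e =ᵐ[G.edgeMeasure e] fun x => γ e (Sobolev.fn u e x)) ∧
    ∀ φ : G.Sobolev p, G.pairing v φ + G.pLaplaceForm p u φ
      = G.pairing f φ + ∑ a, ω a * Sobolev.vertexValue φ a

/-- The operator `𝒜` in `X`, as a graph: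
`((v, 0), (ṽ, ω)) ∈ 𝒜` iff `v` is a weak solution of the elliptic problem with the data
`f = v + ṽ` and `ω`. -/
def graphOperator (γ : E → ℝ → ℝ) : Set (G.StateSpace × G.StateSpace) :=
  {P | P.1.snd = 0 ∧
    G.IsEllipticWeakSolution p γ (P.1.fst + P.2.fst) P.2.snd P.1.fst}

/-! ### The evolution problem -/

variable {p} in
/-- `u ∈ L^p(0, T; 𝒲^{1,p}(G))`: `u ∈ L¹(0, T; 𝒲^{1,p}(G))` and
`[u]ₑ ∈ L^{pₑ}(0, T; W^{1,pₑ}(0, ℓₑ))` for every edge `e`. -/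
def MemLpTime (T : ℝ) (u : ℝ → G.Sobolev p) : Prop :=
  IntegrableOn u (Ioo 0 T) ∧
    ∀ e, MemLp (fun t => (u t : G.PairSpace p) e) (p e) (volume.restrict (Ioo 0 T))

/-- `𝒲^{1,1}(G)`. -/
abbrev SobolevOne : Submodule ℝ (G.PairSpace fun _ => 1) := G.Sobolev fun _ => 1

variable {p} in
/-- `ψ ∈ W^{1,1}(0, T; 𝒲^{1,1}(G)) ∩ L^p(0, T; 𝒲^{1,p}(G))` with `ψ(0) = ψ(T) = 0`. Here `ψ` is
the continuous representative, `ψ'` is its time derivative (in the sense of distributions with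
values in the Banach space of pairs that contains `𝒲^{1,1}(G)`), and `ψp` is the same function as
`ψ`, read as a function with values in `𝒲^{1,p}(G)`. -/
structure IsEvolutionTest (T : ℝ) (ψ ψ' : ℝ → G.SobolevOne) (ψp : ℝ → G.Sobolev p) : Prop where
  continuousOn : ContinuousOn ψ (Icc 0 T)
  integrable_deriv : IntegrableOn ψ' (Ioo 0 T)
  hasWeakDeriv : HasWeakDeriv 0 T (fun t => (ψ t : G.PairSpace fun _ => 1))
    (fun t => (ψ' t : G.PairSpace fun _ => 1))
  memLp : G.MemLpTime T ψp
  same : ∀ᵐ t ∂(volume.restrict (Ioo 0 T)), ∀ e,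
    Sobolev.fn (ψp t) e =ᵐ[G.edgeMeasure e] Sobolev.fn (ψ t) e
  zero_left : ψ 0 = 0
  zero_right : ψ T = 0

/-- `v : [0, ∞) → L¹(G)` is a weak solution of the evolution problem
`∂ₜ v - Δ_p u = f`, `v = γ(u)`, `u` continuous, with the flux `ω` at the vertices and with
`v(0) = v₀`. -/
structure IsEvolutionWeakSolution (γ : E → ℝ → ℝ) (f : ℝ → G.L1) (ω : ℝ → G.VertexL1)
    (v₀ : G.L1) (v : ℝ → G.L1) : Prop where
  initial : v 0 = v₀
  continuousOn : ∀ T : ℝ, 0 < T → ContinuousOn v (Icc 0 T)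
  equation : ∀ T : ℝ, 0 < T → ∃ u : ℝ → G.Sobolev p, G.MemLpTime T u ∧
    (∀ᵐ t ∂(volume.restrict (Ioo 0 T)), ∀ e,
      v t e =ᵐ[G.edgeMeasure e] fun x => γ e (Sobolev.fn (u t) e x)) ∧
    ∀ (ψ ψ' : ℝ → G.SobolevOne) (ψp : ℝ → G.Sobolev p), G.IsEvolutionTest T ψ ψ' ψp →
      - (∫ t in Ioo 0 T, G.pairing (v t) (ψ' t)) + ∫ t in Ioo 0 T, G.pLaplaceForm p (u t) (ψp t)
        = (∫ t in Ioo 0 T, G.pairing (f t) (ψ t))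
          + ∑ a, ∫ t in Ioo 0 T, ω t a * Sobolev.vertexValue (ψ t) a

end CompactMetricGraph

end

/-! ### Sobolev functions of one variable -/

namespace IsScalarTest

variable {a b : ℝ} {φ : ℝ → ℝ}

/-! Let `((z, 0), (ṽ, ω̃)) ∈ 𝒜` with `z = γ(w)`. Formally, one subtracts the stationary equation
from the evolution equation and tests with `sign(u - w) = sign(v - z)`. The monotone `p`-Laplacian
contributes with the favourable sign, and what remains is bounded by the bracket. Two things are
missing: the sign is not an admissible test function in space, and `v` has no time derivative in
`L¹(G)`.

For the first, let `β` be the inverse of `γ`, let `S_n` be smooth and tend to the sign function, and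
put `J_n(v) = ∑ₑ ∫ ∫_{γ(w)}^{v} S_n(β(ρ) - w) dρ dx`. This functional is convex and 1-Lipschitz on
`L¹(G)` and tends to `‖v - z‖`. At `v = γ(u)` it has the subgradient `S_n(β(v) - w) = S_n(u - w)`,
which does lie in `𝒲^{1,p}(G)`.

For the second, only backward differences are used. With `φ_s = S_n(u(s) - w)`, convexity gives
`J_n(v(s)) - J_n(v(s-h)) ≤ ⟨v(s) - v(s-h), φ_s⟩`. As `φ_s` does not depend on the integration time,
the right-hand side is the integral over `[s-h, s]` of the source terms tested with `φ_s`
(`hasWeakDeriv_pairing`, `pairing_sub_eq_integral`). Freezing these terms at time `s` costs an error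
that is controlled by translates of the data in `L¹` and of the fluxes in the conjugate space of
each `L^{pₑ}`. Translations are continuous there because the conjugate exponent is finite, so the
error, integrated in `s` and divided by `h`, vanishes as `h → 0`. The fluxes are measurable in time
by `continuous_nemytskii`.

At the frozen time, monotonicity (`pLaplaceForm_le`) leaves `⟨f - ṽ, φ_s⟩ + ∑ₐ (ω - ω̃)ₐ φ_s(a)`.
The subgradient inequality, used a second time, bounds the first term by `(J_n(v + r(f - ṽ)) -
J_n(v)) / r`; the second is at most `‖ω - ω̃‖`. These are the quantities that turn into the
difference quotient of the norm of `X`, so no explicit formula for the bracket is needed. The limits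
are taken in the order `h → 0` (`neg_integral_entropyFunctional_le`), `n → ∞`, `r → 0`
(`neg_integral_norm_sub_le`). -/

theorem eq_zero (h : IsScalarTest a b φ) {x : ℝ} (hx : x ∉ Ioo a b) : φ x = 0 :=
  image_eq_zero_of_notMem_tsupport fun hx' => hx (h.support hx')

theorem continuous_deriv (h : IsScalarTest a b φ) : Continuous (deriv φ) :=
  h.smooth.continuous_deriv (by simp)

theorem differentiable (h : IsScalarTest a b φ) : Differentiable ℝ φ :=
  h.smooth.differentiable (by simp)

theorem absolutelyContinuousOnInterval (h : IsScalarTest a b φ) :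
    AbsolutelyContinuousOnInterval φ a b :=
  (h.smooth.of_le (by exact_mod_cast le_top)).contDiffOn.absolutelyContinuousOnInterval

theorem integral_deriv (h : IsScalarTest a b φ) (hab : a ≤ b) : ∫ x in Ioo a b, deriv φ x = 0 := by
  rw [← integral_Ioc_eq_integral_Ioo, ← intervalIntegral.integral_of_le hab,
    h.absolutelyContinuousOnInterval.integral_deriv_eq_sub, h.eq_zero (by simp),
    h.eq_zero (by simp), sub_zero]

theorem mul {ψ : ℝ → ℝ} (h : IsScalarTest a b φ) (hψ : IsScalarTest a b ψ) :
    IsScalarTest a b fun x => φ x * ψ x where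
  smooth := h.smooth.mul hψ.smooth
  compact := h.compact.mul_right
  support := (tsupport_mul_subset_left (f := φ) (g := ψ)).trans h.support

theorem exists_Icc (h : IsScalarTest a b φ) (hab : a < b) :
    ∃ c d, a < c ∧ c ≤ d ∧ d < b ∧ ∀ x, x ∉ Icc c d → φ x = 0 := by
  -- The midpoint is added so that the compact set is nonempty even for `φ = 0`.
  have hK : IsCompact (insert ((a + b) / 2) (tsupport φ)) := h.compact.isCompact.insert _
  have hsub : insert ((a + b) / 2) (tsupport φ) ⊆ Ioo a b :=
    insert_subset ⟨by linarith, by linarith⟩ h.support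
  have hne : (insert ((a + b) / 2) (tsupport φ)).Nonempty := insert_nonempty _ _
  have h1 := hsub (hK.sInf_mem hne)
  have h2 := hsub (hK.sSup_mem hne)
  refine ⟨_, _, h1.1, csInf_le_csSup hne hK.bddBelow hK.bddAbove, h2.2, fun x hx => ?_⟩
  refine image_eq_zero_of_notMem_tsupport fun hx' => hx ?_
  exact ⟨csInf_le hK.bddBelow (mem_insert_of_mem _ hx'),
    le_csSup hK.bddAbove (mem_insert_of_mem _ hx')⟩

theorem of_Icc {c d : ℝ} (hφ : ContDiff ℝ ((⊤ : ℕ∞) : WithTop ℕ∞) φ) (hac : a < c) (hdb : d < b)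
    (h : ∀ x, x ∉ Icc c d → φ x = 0) : IsScalarTest a b φ := by
  have hs : tsupport φ ⊆ Icc c d :=
    closure_minimal (fun x hx => by_contra fun hx' => hx (h x hx')) isClosed_Icc
  exact ⟨hφ, isCompact_Icc.of_isClosed_subset (isClosed_tsupport _) hs,
    hs.trans (Icc_subset_Ioo hac hdb)⟩

/-- A test function with vanishing integral is the derivative of a test function. -/
theorem exists_primitive (h : IsScalarTest a b φ) (hab : a < b)
    (h0 : ∫ x in Ioo a b, φ x = 0) : ∃ ψ, IsScalarTest a b ψ ∧ deriv ψ = φ := by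
  obtain ⟨c, d, hac, hcd, hdb, hout⟩ := h.exists_Icc hab
  have hcont := h.smooth.continuous
  have hder : ∀ x, HasDerivAt (fun x => ∫ t in a..x, φ t) (φ x) x := fun x =>
    intervalIntegral.integral_hasDerivAt_right (hcont.intervalIntegrable _ _)
      (hcont.stronglyMeasurableAtFilter _ _) hcont.continuousAt
  have hd : deriv (fun x => ∫ t in a..x, φ t) = φ := funext fun x => (hder x).deriv
  have hb : ∫ t in a..b, φ t = 0 := by
    rw [intervalIntegral.integral_of_le hab.le, integral_Ioc_eq_integral_Ioo, h0]
  refine ⟨fun x => ∫ t in a..x, φ t, of_Icc ?_ hac hdb fun x hx => ?_, hd⟩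
  · rw [contDiff_infty_iff_deriv, hd]
    exact ⟨fun x => (hder x).differentiableAt, h.smooth⟩
  -- To the left of the support nothing has been integrated yet; to the right the primitive equals
  -- the total integral, which is zero.
  · rcases lt_or_ge x c with hxc | hxc
    · refine intervalIntegral.integral_zero_ae (ae_of_all _ fun t ht => hout t fun ht' => ?_)
      rcases mem_uIoc.1 ht with h1 | h1
      · linarith [ht'.1, h1.2]
      · linarith [ht'.1, h1.2]
    · have hxd : d < x := not_le.1 fun h' => hx ⟨hxc, h'⟩
      have h1 : ∫ t in b..x, φ t = 0 := by
        refine intervalIntegral.integral_zero_ae (ae_of_all _ fun t ht => hout t fun ht' => ?_)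
        rcases mem_uIoc.1 ht with h1 | h1
        · linarith [ht'.2, h1.1]
        · linarith [ht'.2, h1.1]
      change ∫ t in a..x, φ t = 0
      rw [← intervalIntegral.integral_add_adjacent_intervals (hcont.intervalIntegrable a b)
        (hcont.intervalIntegrable b x), hb, h1, add_zero]

end IsScalarTest

theorem exists_isScalarTest_integral_eq_one {a b : ℝ} (hab : a < b) :
    ∃ φ : ℝ → ℝ, IsScalarTest a b φ ∧ ∫ x in Ioo a b, φ x = 1 := by
  let B : ContDiffBump ((a + b) / 2) := ⟨(b - a) / 8, (b - a) / 4, by linarith, by linarith⟩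
  have hφ : IsScalarTest a b (B.normed volume) := by
    refine IsScalarTest.of_Icc (c := (a + b) / 2 - (b - a) / 4) (d := (a + b) / 2 + (b - a) / 4)
      B.contDiff_normed (by linarith) (by linarith) fun x hx => ?_
    refine image_eq_zero_of_notMem_tsupport fun hx' => hx ?_
    rw [B.tsupport_normed_eq, Real.closedBall_eq_Icc] at hx'
    exact hx'
  refine ⟨_, hφ, ?_⟩
  rw [setIntegral_eq_integral_of_forall_compl_eq_zero fun x hx => hφ.eq_zero hx]
  exact B.integral_normed

/-- The lemma of du Bois-Reymond. -/
theorem ae_eq_const_of_integral_deriv_mul_eq_zero {a b : ℝ} (hab : a < b) {h : ℝ → ℝ}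
    (hh : IntegrableOn h (Ioo a b))
    (H : ∀ φ, IsScalarTest a b φ → ∫ x in Ioo a b, deriv φ x * h x = 0) :
    ∃ c, h =ᵐ[volume.restrict (Ioo a b)] fun _ => c := by
  obtain ⟨φ₀, hφ₀, h1⟩ := exists_isScalarTest_integral_eq_one hab
  set c := ∫ x in Ioo a b, φ₀ x * h x with hc
  refine ⟨c, ?_⟩
  have hconst : IntegrableOn (fun _ : ℝ => c) (Ioo a b) := by simp
  have hone : IntegrableOn (fun _ : ℝ => (1 : ℝ)) (Ioo a b) := by simp
  have key := IsOpen.ae_eq_zero_of_integral_contDiff_smul_eq_zero (μ := volume)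
    (U := Ioo a b) (f := fun x => h x - c) isOpen_Ioo
    (hh.sub hconst).locallyIntegrableOn ?_
  · rw [Filter.EventuallyEq, ae_restrict_iff' measurableSet_Ioo]
    filter_upwards [key] with x hx hx'
    linarith [hx hx']
  · intro φ hs hcs hsub
    have hφ : IsScalarTest a b φ := ⟨hs, hcs, hsub⟩
    have hiφ : IntegrableOn φ (Ioo a b) := by
      simpa [IntegrableOn] using (hφ.integrable_mul hone).1
    have hiφ₀ : IntegrableOn φ₀ (Ioo a b) := by
      simpa [IntegrableOn] using (hφ₀.integrable_mul hone).1
    set k := ∫ x in Ioo a b, φ x with hk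
    -- Subtracting the multiple `k φ₀` makes the integral vanish, so that the difference is the
    -- derivative of a test function and `H` applies.
    have hχ : IsScalarTest a b fun x => φ x - k * φ₀ x := by
      refine ⟨hφ.smooth.sub (contDiff_const.mul hφ₀.smooth),
        hφ.compact.sub (hφ₀.compact.mul_left (f := fun _ => k)), ?_⟩
      refine (tsupport_sub _ _).trans (union_subset hφ.support ?_)
      exact (tsupport_mul_subset_right (f := fun _ => k) (g := φ₀)).trans hφ₀.support
    have hχ0 : ∫ x in Ioo a b, (φ x - k * φ₀ x) = 0 := by
      rw [integral_sub hiφ (hiφ₀.const_mul k), integral_const_mul, h1, mul_one, sub_self]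
    obtain ⟨ψ, hψ, hψd⟩ := hχ.exists_primitive hab hχ0
    have h2 := H ψ hψ
    rw [hψd] at h2
    rw [← setIntegral_eq_integral_of_forall_compl_eq_zero
      (fun x hx => by rw [hφ.eq_zero hx, zero_smul] : ∀ x, x ∉ Ioo a b → φ x • (h x - c) = 0)]
    have h3 : ∫ x in Ioo a b, (φ x - k * φ₀ x) * h x
        = (∫ x in Ioo a b, φ x * h x) - k * c := by
      rw [hc, ← integral_const_mul, ← integral_sub (hφ.integrable_mul hh).1
        ((hφ₀.integrable_mul hh).1.const_mul k)]
      exact integral_congr_ae (ae_of_all _ fun x => by ring)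
    have h4 : ∫ x in Ioo a b, φ x • (h x - c) = (∫ x in Ioo a b, φ x * h x) - k * c := by
      rw [hk, ← integral_mul_const, ← integral_sub (hφ.integrable_mul hh).1 (hiφ.mul_const c)]
      exact integral_congr_ae (ae_of_all _ fun x => by simp [mul_sub])
    rw [h4, ← h3, h2]

theorem HasWeakDeriv.congr {a b : ℝ} {u u' g g' : ℝ → ℝ} (h : HasWeakDeriv a b u g)
    (hu : u =ᵐ[volume.restrict (Ioo a b)] u') (hg : g =ᵐ[volume.restrict (Ioo a b)] g') :
    HasWeakDeriv a b u' g' := by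
  intro φ hφ
  have := h φ hφ
  rw [integral_congr_ae (hu.mono fun x hx => by simp only [hx] :
      (fun x => deriv φ x • u x) =ᵐ[volume.restrict (Ioo a b)] fun x => deriv φ x • u' x),
    integral_congr_ae (hg.mono fun x hx => by simp only [hx] :
      (fun x => φ x • g x) =ᵐ[volume.restrict (Ioo a b)] fun x => φ x • g' x)] at this
  exact this

/-- Integration by parts holds for absolutely continuous functions, and the boundary terms vanish
with `φ`. -/
theorem AbsolutelyContinuousOnInterval.hasWeakDeriv {a b : ℝ} (hab : a ≤ b) {W : ℝ → ℝ}
    (hW : AbsolutelyContinuousOnInterval W a b) : HasWeakDeriv a b W (deriv W) := by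
  intro φ hφ
  have := hφ.absolutelyContinuousOnInterval.integral_mul_deriv_eq_deriv_mul hW
  rw [hφ.eq_zero (by simp), hφ.eq_zero (by simp), intervalIntegral.integral_of_le hab,
    intervalIntegral.integral_of_le hab, integral_Ioc_eq_integral_Ioo,
    integral_Ioc_eq_integral_Ioo] at this
  simp only [smul_eq_mul]
  linarith

theorem intervalIntegrable_of_integrableOn_Ioo {a b : ℝ} (hab : a ≤ b) {g : ℝ → ℝ}
    (hg : IntegrableOn g (Ioo a b)) : IntervalIntegrable g volume a b :=
  (intervalIntegrable_iff_integrableOn_Ioo_of_le hab).2 hg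

theorem absolutelyContinuousOnInterval_primitive {a b : ℝ} (hab : a ≤ b) {g : ℝ → ℝ}
    (hg : IntegrableOn g (Ioo a b)) (c : ℝ) :
    AbsolutelyContinuousOnInterval (fun x => c + ∫ t in a..x, g t) a b :=
  (LipschitzOnWith.absolutelyContinuousOnInterval (K := 0) (f := fun _ => c)
      (LipschitzWith.const c).lipschitzOnWith).add
    ((intervalIntegrable_of_integrableOn_Ioo hab hg).absolutelyContinuousOnInterval_intervalIntegral
      left_mem_uIcc)

theorem ae_hasDerivAt_primitive {a b : ℝ} (hab : a ≤ b) {g : ℝ → ℝ}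
    (hg : IntegrableOn g (Ioo a b)) (c : ℝ) :
    ∀ᵐ x ∂(volume.restrict (Ioo a b)), HasDerivAt (fun x => c + ∫ t in a..x, g t) (g x) x := by
  rw [ae_restrict_iff' measurableSet_Ioo]
  filter_upwards [(intervalIntegrable_of_integrableOn_Ioo hab hg).ae_hasDerivAt_integral]
    with x hx hx'
  exact (hx (by rw [uIcc_of_le hab]; exact Ioo_subset_Icc_self hx') a left_mem_uIcc).const_add c

/-- An integrable function with an integrable weak derivative is a primitive of it. -/
theorem HasWeakDeriv.exists_primitive {a b : ℝ} (hab : a < b) {u g : ℝ → ℝ}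
    (hu : IntegrableOn u (Ioo a b)) (hg : IntegrableOn g (Ioo a b)) (h : HasWeakDeriv a b u g) :
    ∃ c, u =ᵐ[volume.restrict (Ioo a b)] fun x => c + ∫ t in a..x, g t := by
  have hac := absolutelyContinuousOnInterval_primitive hab.le hg 0
  have hw := (hac.hasWeakDeriv hab.le).congr EventuallyEq.rfl
    ((ae_hasDerivAt_primitive hab.le hg 0).mono fun x hx => hx.deriv)
  have hi : IntegrableOn (fun x => 0 + ∫ t in a..x, g t) (Ioo a b) := by
    have := hac.continuousOn
    rw [uIcc_of_le hab.le] at this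
    exact this.integrableOn_Icc.mono_set Ioo_subset_Icc_self
  -- The primitive of `g` has the same weak derivative as `u`, so the difference is constant by du
  -- Bois-Reymond.
  obtain ⟨c, hc⟩ := ae_eq_const_of_integral_deriv_mul_eq_zero hab
    (h := fun x => u x - (0 + ∫ t in a..x, g t)) (hu.sub hi) fun φ hφ => by
      have h1 := h φ hφ
      have h2 := hw φ hφ
      simp only [smul_eq_mul] at h1 h2
      simp only [mul_sub]
      rw [integral_sub (hφ.integrable_mul hu).2 (hφ.integrable_mul hi).2, h1, h2, sub_self]
  exact ⟨c, hc.mono fun x hx => by linarith⟩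

/-- A Lipschitz map multiplies every sum of increments by at most its constant. -/
theorem AbsolutelyContinuousOnInterval.lipschitz_comp {a b : ℝ} {W : ℝ → ℝ}
    (hW : AbsolutelyContinuousOnInterval W a b) {S : ℝ → ℝ} {K : NNReal} (hS : LipschitzWith K S) :
    AbsolutelyContinuousOnInterval (fun x => S (W x)) a b := by
  unfold AbsolutelyContinuousOnInterval at hW ⊢
  have h0 := hW.const_mul (K : ℝ)
  rw [mul_zero] at h0
  refine squeeze_zero (fun _ => Finset.sum_nonneg fun _ _ => dist_nonneg) (fun I => ?_) h0
  rw [Finset.mul_sum]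
  exact Finset.sum_le_sum fun i _ => hS.dist_le_mul _ _

/-- The chain rule for weak derivatives. -/
theorem hasWeakDeriv_comp_primitive {a b : ℝ} (hab : a ≤ b) {g : ℝ → ℝ}
    (hg : IntegrableOn g (Ioo a b)) (c : ℝ) {S S' : ℝ → ℝ} {K : NNReal} (hS : LipschitzWith K S)
    (hS' : ∀ y, HasDerivAt S (S' y) y) :
    HasWeakDeriv a b (fun x => S (c + ∫ t in a..x, g t))
      (fun x => S' (c + ∫ t in a..x, g t) * g x) :=
  (((absolutelyContinuousOnInterval_primitive hab hg c).lipschitz_comp hS).hasWeakDeriv hab).congr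
    EventuallyEq.rfl ((ae_hasDerivAt_primitive hab hg c).mono fun x hx =>
      ((hS' _).comp x hx).deriv)

/-! ### The Nemytskii operator of the `p`-Laplacian -/

/-- `|y|^{p-2} y`, as a function of the real variable `y`. -/
noncomputable def signedPow (r : ℝ) (y : ℝ) : ℝ := |y| ^ (r - 2) * y

theorem abs_signedPow {r : ℝ} (hr : 1 < r) (y : ℝ) : |signedPow r y| = |y| ^ (r - 1) := by
  unfold signedPow
  -- At `0` the power with exponent `r - 2`, possibly negative, has a default value, but it is
  -- multiplied by `0`.
  rcases eq_or_ne y 0 with rfl | hy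
  · rw [mul_zero, abs_zero, Real.zero_rpow (by linarith)]
  · have h : 0 < |y| := abs_pos.2 hy
    rw [abs_mul, abs_of_nonneg (Real.rpow_nonneg h.le _)]
    nth_rw 2 [← Real.rpow_one |y|]
    rw [← Real.rpow_add h]
    congr 1
    ring

theorem signedPow_neg (r y : ℝ) : signedPow r (-y) = -signedPow r y := by
  simp [signedPow]

theorem signedPow_of_nonneg {r : ℝ} (hr : 1 < r) {y : ℝ} (hy : 0 ≤ y) :
    signedPow r y = y ^ (r - 1) := by
  rw [← abs_of_nonneg (a := signedPow r y) (mul_nonneg (Real.rpow_nonneg (abs_nonneg y) _) hy),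
    abs_signedPow hr, abs_of_nonneg hy]

theorem signedPow_mono {r : ℝ} (hr : 1 < r) : Monotone (signedPow r) := by
  have hnn : ∀ x y : ℝ, 0 ≤ x → x ≤ y → signedPow r x ≤ signedPow r y := fun x y hx hxy => by
    rw [signedPow_of_nonneg hr hx, signedPow_of_nonneg hr (hx.trans hxy)]
    exact Real.rpow_le_rpow hx hxy (by linarith)
  have h0 : signedPow r 0 = 0 := by simp [signedPow]
  intro x y hxy
  rcases le_total 0 x with hx | hx
  · exact hnn x y hx hxy
  · rcases le_total 0 y with hy | hy
    · have h1 := hnn 0 (-x) le_rfl (by linarith)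
      have h2 := hnn 0 y le_rfl hy
      rw [signedPow_neg] at h1
      linarith
    · have h1 := hnn (-y) (-x) (by linarith) (by linarith)
      rw [signedPow_neg, signedPow_neg] at h1
      linarith

theorem continuous_signedPow {r : ℝ} (hr : 1 < r) : Continuous (signedPow r) := by
  -- In this form only the positive exponent `r - 1` occurs, so continuity at `0` is visible.
  have h : signedPow r = fun y => max y 0 ^ (r - 1) - max (-y) 0 ^ (r - 1) := by
    funext y
    rcases le_total 0 y with hy | hy
    · rw [signedPow_of_nonneg hr hy, max_eq_left hy, max_eq_right (by linarith),
        Real.zero_rpow (by linarith), sub_zero]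
    · rw [← neg_neg y, signedPow_neg, signedPow_of_nonneg hr (by linarith), neg_neg,
        max_eq_right hy, max_eq_left (by linarith : (0 : ℝ) ≤ -y),
        Real.zero_rpow (by linarith), zero_sub]
  rw [h]
  exact ((continuous_id.max continuous_const).rpow_const fun _ => Or.inr (by linarith)).sub
    ((continuous_id.neg.max continuous_const).rpow_const fun _ => Or.inr (by linarith))

section Nemytskii

variable {α : Type*} [MeasurableSpace α] {μ : Measure α} {p q : ℝ≥0∞}

/-- Conjugate exponents satisfy `(p - 1) q = p`. No measurability is needed, so the identity also
serves for restrictions to sets. -/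
theorem eLpNorm_signedPow (hp : 1 < p) (hp_top : p < ∞) (hpq : p.HolderConjugate q) (g : α → ℝ) :
    eLpNorm (fun x => signedPow p.toReal (g x)) q μ = eLpNorm g p μ ^ (p.toReal - 1) := by
  have hr : 1 < p.toReal := by
    rw [← ENNReal.toReal_one]; exact (ENNReal.toReal_lt_toReal (by simp) hp_top.ne).2 hp
  have hq : q ≠ ∞ := fun h => by
    have := (ENNReal.HolderConjugate.eq_top_iff_eq_one q p).1 h
    exact hp.ne' this
  have hc : p.toReal.HolderConjugate q.toReal := ENNReal.HolderConjugate.toReal hr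
  have h1 : eLpNorm (fun x => signedPow p.toReal (g x)) q μ
      = eLpNorm (fun x => ‖g x‖ ^ (p.toReal - 1)) q μ :=
    eLpNorm_congr_norm_ae (ae_of_all _ fun x => by
      rw [Real.norm_eq_abs, abs_signedPow hr, Real.norm_eq_abs, Real.norm_eq_abs,
        abs_of_nonneg (Real.rpow_nonneg (abs_nonneg _) _)])
  rw [h1, eLpNorm_norm_rpow g (by linarith)]
  congr 2
  rw [← ENNReal.toReal_eq_toReal_iff' (ENNReal.mul_ne_top hq (by simp)) hp_top.ne,
    ENNReal.toReal_mul, ENNReal.toReal_ofReal (by linarith), mul_comm]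
  exact hc.sub_one_mul_conj

theorem MeasureTheory.MemLp.signedPow (hp : 1 < p) (hp_top : p < ∞) (hpq : p.HolderConjugate q)
    {g : α → ℝ} (hg : MemLp g p μ) : MemLp (fun x => signedPow p.toReal (g x)) q μ := by
  have hr : 1 < p.toReal := by
    rw [← ENNReal.toReal_one]; exact (ENNReal.toReal_lt_toReal (by simp) hp_top.ne).2 hp
  refine ⟨(continuous_signedPow hr).comp_aestronglyMeasurable hg.1, ?_⟩
  rw [eLpNorm_signedPow hp hp_top hpq]
  exact ENNReal.rpow_lt_top_of_nonneg (by linarith) hg.2.ne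

/-- The Nemytskii operator `g ↦ |g|^{p-2} g` from `Lᵖ` to the dual space. -/
noncomputable def nemytskii (hp : 1 < p) (hp_top : p < ∞) (hpq : p.HolderConjugate q)
    (g : Lp ℝ p μ) : Lp ℝ q μ :=
  ((Lp.memLp g).signedPow hp hp_top hpq).toLp _

theorem coeFn_nemytskii (hp : 1 < p) (hp_top : p < ∞) (hpq : p.HolderConjugate q)
    (g : Lp ℝ p μ) : nemytskii hp hp_top hpq g =ᵐ[μ] fun x => signedPow p.toReal (g x) :=
  MemLp.coeFn_toLp _

theorem enorm_nemytskii (hp : 1 < p) (hp_top : p < ∞) (hpq : p.HolderConjugate q)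
    (g : Lp ℝ p μ) : ‖nemytskii hp hp_top hpq g‖ₑ = ‖g‖ₑ ^ (p.toReal - 1) := by
  rw [nemytskii, Lp.enorm_toLp, eLpNorm_signedPow hp hp_top hpq, Lp.enorm_def]

/-- Since `signedPow` vanishes at `0`, it commutes with indicators, and `eLpNorm_signedPow`
transfers smallness on small sets; the tolerance `ε` corresponds to `ε^{1/(p-1)}` for `g`. -/
theorem MeasureTheory.UnifIntegrable.signedPow {ι : Type*} (hp : 1 < p) (hp_top : p < ∞)
    (hpq : p.HolderConjugate q) {g : ι → α → ℝ} (hg : UnifIntegrable g p μ) :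
    UnifIntegrable (fun n x => signedPow p.toReal (g n x)) q μ := by
  have hr : 0 < p.toReal - 1 := by
    rw [sub_pos, ← ENNReal.toReal_one]
    exact (ENNReal.toReal_lt_toReal (by simp) hp_top.ne).2 hp
  intro ε hε
  obtain ⟨δ, hδ, h⟩ := hg (Real.rpow_pos_of_pos hε (p.toReal - 1)⁻¹)
  refine ⟨δ, hδ, fun n s hs hμs => ?_⟩
  have h1 : s.indicator (fun x => _root_.signedPow p.toReal (g n x))
      = fun x => _root_.signedPow p.toReal (s.indicator (g n) x) := by
    funext x
    by_cases hx : x ∈ s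
    · rw [indicator_of_mem hx, indicator_of_mem hx]
    · rw [indicator_of_notMem hx, indicator_of_notMem hx, _root_.signedPow, mul_zero]
  rw [h1, eLpNorm_signedPow hp hp_top hpq]
  refine (ENNReal.rpow_le_rpow (h n s hs hμs) hr.le).trans_eq ?_
  rw [ENNReal.ofReal_rpow_of_nonneg (Real.rpow_nonneg hε.le _) hr.le, ← Real.rpow_mul hε.le,
    inv_mul_cancel₀ hr.ne', Real.rpow_one]

/-- Vitali's theorem: a convergent sequence in `Lᵖ` is uniformly integrable, every subsequence has a
further one converging a.e., and both properties pass to the images. Continuity makes `t ↦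
|u(t)'|^{p-2} u(t)'` strongly measurable as a map into the dual space. -/
theorem continuous_nemytskii [IsFiniteMeasure μ] [Fact (1 ≤ p)] [Fact (1 ≤ q)] (hp : 1 < p)
    (hp_top : p < ∞) (hpq : p.HolderConjugate q) :
    Continuous (nemytskii (μ := μ) hp hp_top hpq) := by
  have hr : 1 < p.toReal := by
    rw [← ENNReal.toReal_one]; exact (ENNReal.toReal_lt_toReal (by simp) hp_top.ne).2 hp
  have hq : q ≠ ∞ := fun h => hp.ne' ((ENNReal.HolderConjugate.eq_top_iff_eq_one q p).1 h)
  refine SeqContinuous.continuous fun g g₀ hg => ?_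
  have hg' := hg
  rw [Lp.tendsto_Lp_iff_tendsto_eLpNorm'] at hg'
  refine (Lp.tendsto_Lp_iff_tendsto_eLpNorm'' (fun n x => signedPow p.toReal (g n x))
    (fun n => (Lp.memLp (g n)).signedPow hp hp_top hpq) (fun x => signedPow p.toReal (g₀ x))
    ((Lp.memLp g₀).signedPow hp hp_top hpq)).2 ?_
  have hui := (unifIntegrable_of_tendsto_Lp hp.le hp_top.ne (fun n => Lp.memLp (g n))
    (Lp.memLp g₀) hg').signedPow hp hp_top hpq
  refine tendsto_of_subseq_tendsto fun ns hns => ?_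
  obtain ⟨ms, -, hms⟩ := (tendstoInMeasure_of_tendsto_Lp (hg.comp hns)).exists_seq_tendsto_ae
  refine ⟨ms, tendsto_Lp_finite_of_tendsto_ae Fact.out hq
    (fun n => ((Lp.memLp (g (ns (ms n)))).signedPow hp hp_top hpq).1)
    ((Lp.memLp g₀).signedPow hp hp_top hpq) (fun ε hε => ?_) ?_⟩
  · obtain ⟨δ, hδ, h⟩ := hui hε
    exact ⟨δ, hδ, fun n => h _⟩
  · filter_upwards [hms] with x hx
    exact ((continuous_signedPow hr).tendsto _).comp hx

end Nemytskii

/-! ### Translations in `Lᵖ` -/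

section Translation

variable {F : Type*} [NormedAddCommGroup F] {q : ℝ≥0∞}

/-- For finite `q` the action of `ℝ` on `L^q` by translations is continuous. -/
theorem tendsto_eLpNorm_translate_sub (hq1 : 1 ≤ q) (hq : q ≠ ∞) {f : ℝ → F}
    (hf : MemLp f q volume) :
    Tendsto (fun σ : ℝ => eLpNorm (fun s => f (s - σ) - f s) q volume) (𝓝 0) (𝓝 0) := by
  have : Fact (1 ≤ q) := ⟨hq1⟩
  have : Fact (q ≠ ∞) := ⟨hq⟩
  -- The action composes `f` with `s ↦ c + s`, hence the sign `c = -σ`.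
  have hcont : Continuous fun σ : ℝ => DomAddAct.mk (-σ) +ᵥ hf.toLp f :=
    (DomAddAct.continuous_mk.comp continuous_neg).vadd continuous_const
  have h0 := hcont.tendsto 0
  rw [neg_zero, DomAddAct.mk_zero, zero_vadd] at h0
  have h1 := (Lp.tendsto_Lp_iff_tendsto_eLpNorm'' (fun σ : ℝ => fun s => f (-σ +ᵥ s))
    (fun σ => hf.comp_measurePreserving (measurePreserving_vadd (-σ) volume)) f hf).1 h0
  refine h1.congr fun σ => ?_
  congr 1
  funext s
  simp only [Pi.sub_apply, vadd_eq_add]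
  rw [neg_add_eq_sub]

theorem aemeasurable_translate {f : ℝ → F} (hf : AEStronglyMeasurable f volume) {M : ℝ → ℝ}
    (hM : AEStronglyMeasurable M volume) (h : ℝ) :
    AEMeasurable (Function.uncurry fun (s σ : ℝ) => ‖M s‖ₑ * ‖f (s - σ) - f s‖ₑ)
      ((volume : Measure ℝ).prod (volume.restrict (Ioo 0 h))) := by
  refine (hM.comp_quasiMeasurePreserving Measure.quasiMeasurePreserving_fst).enorm.mul ?_
  exact ((hf.comp_quasiMeasurePreserving (quasiMeasurePreserving_sub _ _)).sub
    (hf.comp_quasiMeasurePreserving Measure.quasiMeasurePreserving_fst)).enorm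

/-- By Tonelli and Hölder this is at most the mean over `σ ∈ ]0, h[` of `‖M‖_{q'} ‖f(· - σ) - f‖_q`,
which is small with `σ`. It disposes of the error made when time is frozen at `s`. -/
theorem tendsto_lintegral_translate_sub_div {q' : ℝ≥0∞} (hqq' : q'.HolderConjugate q)
    (hq : q ≠ ∞) [NormedSpace ℝ F] {f : ℝ → F} (hf : MemLp f q volume) {M : ℝ → ℝ}
    (hM : MemLp M q' volume) :
    Tendsto (fun h : ℝ =>
      (∫⁻ s, ∫⁻ σ in Ioo 0 h, ‖M s‖ₑ * ‖f (s - σ) - f s‖ₑ) / ENNReal.ofReal h)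
      (𝓝[>] 0) (𝓝 0) := by
  have hq1 : 1 ≤ q := ENNReal.HolderConjugate.one_le q q'
  rw [ENNReal.tendsto_nhds_zero]
  intro ε hε
  have h1 : Tendsto (fun σ : ℝ => eLpNorm M q' volume *
      eLpNorm (fun s => f (s - σ) - f s) q volume) (𝓝 0) (𝓝 0) := by
    have := ENNReal.Tendsto.const_mul (a := eLpNorm M q' volume)
      (tendsto_eLpNorm_translate_sub hq1 hq hf) (Or.inr hM.2.ne)
    rwa [mul_zero] at this
  obtain ⟨δ, hδ, hball⟩ := Metric.eventually_nhds_iff.1 (ENNReal.tendsto_nhds_zero.1 h1 ε hε)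
  filter_upwards [Ioo_mem_nhdsGT hδ] with h hh
  rw [lintegral_lintegral_swap (aemeasurable_translate hf.1 hM.1 h)]
  refine ENNReal.div_le_of_le_mul ?_
  calc ∫⁻ σ in Ioo 0 h, ∫⁻ s, ‖M s‖ₑ * ‖f (s - σ) - f s‖ₑ
      ≤ ∫⁻ _ in Ioo 0 h, ε := by
        refine setLIntegral_mono measurable_const fun σ hσ => ?_
        have hσ' : dist σ 0 < δ := by
          rw [Real.dist_eq, sub_zero, abs_of_pos hσ.1]; exact hσ.2.trans hh.2
        refine le_trans ?_ (hball hσ')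
        have hfσ : AEStronglyMeasurable (fun s => f (s - σ) - f s) volume :=
          (hf.1.comp_measurePreserving (measurePreserving_sub_right volume σ)).sub hf.1
        have := eLpNorm_smul_le_mul_eLpNorm (p := q') (q := q) (r := 1) hfσ hM.1
        rw [eLpNorm_one_eq_lintegral_enorm] at this
        simpa only [Pi.smul_apply', enorm_smul] using this
    _ = ε * ENNReal.ofReal h := by simp

end Translation

/-! ### Smooth approximations of the sign function -/

/-- `(2 / π) arctan (n y)`, which tends to the sign of `y`. -/
noncomputable def smoothSign (n : ℕ) (y : ℝ) : ℝ := 2 / Real.pi * Real.arctan (n * y)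

/-- The derivative of `smoothSign`. -/
noncomputable def smoothSignDeriv (n : ℕ) (y : ℝ) : ℝ := 2 / Real.pi * (n / (1 + (n * y) ^ 2))

theorem hasDerivAt_smoothSign (n : ℕ) (y : ℝ) :
    HasDerivAt (smoothSign n) (smoothSignDeriv n y) y := by
  have h := (((hasDerivAt_id y).const_mul (n : ℝ)).arctan).const_mul (2 / Real.pi)
  refine h.congr_deriv ?_
  simp only [smoothSignDeriv, id]
  ring

theorem continuous_smoothSign (n : ℕ) : Continuous (smoothSign n) :=
  continuous_iff_continuousAt.2 fun y => (hasDerivAt_smoothSign n y).continuousAt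

theorem continuous_smoothSignDeriv (n : ℕ) : Continuous (smoothSignDeriv n) := by
  unfold smoothSignDeriv
  refine continuous_const.mul (continuous_const.div (by fun_prop) fun y => by positivity)

theorem smoothSignDeriv_nonneg (n : ℕ) (y : ℝ) : 0 ≤ smoothSignDeriv n y := by
  unfold smoothSignDeriv; positivity

theorem smoothSignDeriv_le (n : ℕ) (y : ℝ) : smoothSignDeriv n y ≤ n := by
  have h1 : 2 / Real.pi ≤ 1 := (div_le_one Real.pi_pos).2 Real.two_le_pi
  have h2 : (n : ℝ) / (1 + (n * y) ^ 2) ≤ n :=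
    div_le_self (Nat.cast_nonneg n) (by nlinarith [sq_nonneg ((n : ℝ) * y)])
  calc smoothSignDeriv n y ≤ 1 * n :=
        mul_le_mul h1 h2 (by positivity) zero_le_one
    _ = n := one_mul _

theorem lipschitzWith_smoothSign (n : ℕ) : LipschitzWith n (smoothSign n) := by
  refine lipschitzWith_of_nnnorm_deriv_le
    (fun y => (hasDerivAt_smoothSign n y).differentiableAt) fun y => ?_
  rw [← NNReal.coe_le_coe, coe_nnnorm, (hasDerivAt_smoothSign n y).deriv,
    Real.norm_of_nonneg (smoothSignDeriv_nonneg n y)]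
  simpa using smoothSignDeriv_le n y

theorem monotone_smoothSign (n : ℕ) : Monotone (smoothSign n) := fun x y hxy =>
  mul_le_mul_of_nonneg_left
    (Real.arctan_strictMono.monotone (mul_le_mul_of_nonneg_left hxy (Nat.cast_nonneg n)))
    (by positivity)

theorem abs_smoothSign_le_one (n : ℕ) (y : ℝ) : |smoothSign n y| ≤ 1 := by
  have h1 : |Real.arctan (n * y)| ≤ Real.pi / 2 :=
    abs_le.2 ⟨(Real.neg_pi_div_two_lt_arctan _).le, (Real.arctan_lt_pi_div_two _).le⟩
  rw [smoothSign, abs_mul, abs_of_pos (by positivity)]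
  calc 2 / Real.pi * |Real.arctan (n * y)| ≤ 2 / Real.pi * (Real.pi / 2) := by gcongr
    _ = 1 := by field_simp

theorem tendsto_smoothSign_of_pos {y : ℝ} (hy : 0 < y) :
    Tendsto (fun n => smoothSign n y) atTop (𝓝 1) := by
  have h : Tendsto (fun n : ℕ => (n : ℝ) * y) atTop atTop :=
    tendsto_natCast_atTop_atTop.atTop_mul_const hy
  have h2 := ((tendsto_nhdsWithin_iff.1 Real.tendsto_arctan_atTop).1.comp h).const_mul (2 / Real.pi)
  have h3 : 2 / Real.pi * (Real.pi / 2) = 1 := by field_simp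
  rwa [h3] at h2

theorem smoothSign_neg (n : ℕ) (y : ℝ) : smoothSign n (-y) = -smoothSign n y := by
  simp [smoothSign, Real.arctan_neg]

theorem tendsto_smoothSign_of_neg {y : ℝ} (hy : y < 0) :
    Tendsto (fun n => smoothSign n y) atTop (𝓝 (-1)) := by
  refine (tendsto_smoothSign_of_pos (neg_pos.2 hy)).neg.congr fun n => ?_
  rw [smoothSign_neg, neg_neg]

/-! ### Convex approximations of the distance -/

section Entropy

variable {S β g : ℝ → ℝ}

/-- The convex function `r ↦ ∫_{g a}^r S (β ρ - a) dρ`, where `β` is the inverse function of `g`. -/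
noncomputable def entropy (S β g : ℝ → ℝ) (a r : ℝ) : ℝ := ∫ ρ in g a..r, S (β ρ - a)

/-- Joint continuity is what makes the entropy of two measurable functions measurable. -/
theorem continuous_entropy (hS : Continuous S) (hβ : Continuous β) (hg : Continuous g) :
    Continuous fun x : ℝ × ℝ => entropy S β g x.1 x.2 := by
  -- Both integrals start at `0`, so that only the upper limit and the integrand depend on the
  -- parameters.
  have h0 : ∀ a r : ℝ, entropy S β g a r
      = (∫ ρ in (0 : ℝ)..r, S (β ρ - a)) - ∫ ρ in (0 : ℝ)..g a, S (β ρ - a) := fun a r => by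
    have hc : Continuous fun ρ => S (β ρ - a) := hS.comp (hβ.sub continuous_const)
    rw [intervalIntegral.integral_interval_sub_left (hc.intervalIntegrable _ _)
      (hc.intervalIntegrable _ _), entropy]
  simp only [h0]
  have h1 : ∀ s : ℝ × ℝ → ℝ, Continuous s →
      Continuous fun x : ℝ × ℝ => ∫ ρ in (0 : ℝ)..s x, S (β ρ - x.1) := fun s hs =>
    intervalIntegral.continuous_parametric_intervalIntegral_of_continuous
      (f := fun (x : ℝ × ℝ) ρ => S (β ρ - x.1))
      (hS.comp ((hβ.comp continuous_snd).sub (continuous_fst.comp continuous_fst))) hs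
  exact (h1 _ continuous_snd).sub (h1 _ (hg.comp continuous_fst))

theorem entropy_sub (hS : Continuous S) (hβ : Continuous β) (a r r' : ℝ) :
    entropy S β g a r' - entropy S β g a r = ∫ ρ in r..r', S (β ρ - a) := by
  have hc : Continuous fun ρ => S (β ρ - a) := hS.comp (hβ.sub continuous_const)
  exact intervalIntegral.integral_interval_sub_left (hc.intervalIntegrable _ _)
      (hc.intervalIntegrable _ _)

theorem abs_entropy_sub_le (hS : Continuous S) (hβ : Continuous β) (hS1 : ∀ y, |S y| ≤ 1)
    (a r r' : ℝ) : |entropy S β g a r' - entropy S β g a r| ≤ |r' - r| := by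
  rw [entropy_sub hS hβ]
  have := intervalIntegral.norm_integral_le_of_norm_le_const (a := r) (b := r')
    (f := fun ρ => S (β ρ - a)) (C := 1) fun ρ _ => hS1 _
  rwa [one_mul] at this

theorem entropy_self (a : ℝ) : entropy S β g a (g a) = 0 := intervalIntegral.integral_same

theorem abs_entropy_le (hS : Continuous S) (hβ : Continuous β) (hS1 : ∀ y, |S y| ≤ 1)
    (a r : ℝ) : |entropy S β g a r| ≤ |r - g a| := by
  simpa [entropy_self] using abs_entropy_sub_le (g := g) hS hβ hS1 a (g a) r

/-- This is the subgradient inequality: the derivative `r ↦ S (β r - a)` of the entropy is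
nondecreasing. -/
theorem le_entropy_sub (hS : Continuous S) (hβ : Continuous β) (hSm : Monotone S)
    (hβm : Monotone β) (a r r' : ℝ) :
    S (β r - a) * (r' - r) ≤ entropy S β g a r' - entropy S β g a r := by
  rw [entropy_sub hS hβ]
  have hm : ∀ x y, x ≤ y → S (β x - a) ≤ S (β y - a) := fun x y hxy =>
    hSm (sub_le_sub_right (hβm hxy) a)
  have hc : Continuous fun ρ => S (β ρ - a) := hS.comp (hβ.sub continuous_const)
  have hconst : ∀ x y : ℝ, ∫ _ in x..y, S (β r - a) = S (β r - a) * (y - x) := fun x y => by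
    rw [intervalIntegral.integral_const, smul_eq_mul, mul_comm]
  rcases le_total r r' with h | h
  · rw [← hconst]
    exact intervalIntegral.integral_mono_on (μ := volume) h
      (intervalIntegrable_const (c := S (β r - a))) (hc.intervalIntegrable _ _)
      fun x hx => hm _ _ hx.1
  · have := intervalIntegral.integral_mono_on (μ := volume) h (hc.intervalIntegrable _ _)
      (intervalIntegrable_const (c := S (β r - a))) fun x hx => hm x r hx.2
    rw [hconst] at this
    rw [intervalIntegral.integral_symm]
    linarith

/-- As `β` is strictly increasing with `β (g a) = a`, the sign of `β ρ - a` is that of `ρ - g a`,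
hence constant between `g a` and `r`. Dominated convergence gives the limit. -/
theorem tendsto_entropy_smoothSign (hβ : Continuous β) (hβm : StrictMono β) (a r : ℝ)
    (hg : β (g a) = a) :
    Tendsto (fun n => entropy (smoothSign n) β g a r) atTop (𝓝 |r - g a|) := by
  have hdom : ∀ c : ℝ, (∀ᵐ ρ, ρ ∈ uIoc (g a) r →
      Tendsto (fun n => smoothSign n (β ρ - a)) atTop (𝓝 c)) →
      Tendsto (fun n => entropy (smoothSign n) β g a r) atTop (𝓝 (∫ _ in g a..r, c)) := by
    intro c hc
    refine intervalIntegral.tendsto_integral_filter_of_dominated_convergence (fun _ => 1)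
      (Eventually.of_forall fun n => ?_) (Eventually.of_forall fun n => ae_of_all _ fun ρ _ => ?_)
      (by simp) hc
    · exact ((continuous_smoothSign n).comp (hβ.sub continuous_const)).aestronglyMeasurable
    · exact abs_smoothSign_le_one n _
  rcases le_total (g a) r with h | h
  · have h1 := hdom 1 (ae_of_all _ fun ρ hρ => by
      rw [uIoc_of_le h] at hρ
      refine tendsto_smoothSign_of_pos (sub_pos.2 ?_)
      nth_rw 1 [← hg]
      exact hβm hρ.1)
    rwa [intervalIntegral.integral_const, smul_eq_mul, mul_one,
      ← abs_of_nonneg (sub_nonneg.2 h)] at h1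
  · have h1 := hdom (-1) (by
      -- Here `g a` is the included end of the half-open interval, and the sign is `0` there; it is
      -- a null set.
      filter_upwards [compl_mem_ae_iff.2 (measure_singleton (g a))] with ρ hne hρ
      rw [uIoc_of_ge h] at hρ
      refine tendsto_smoothSign_of_neg (sub_neg.2 ?_)
      have := hβm (lt_of_le_of_ne hρ.2 hne)
      rwa [hg] at this)
    rwa [intervalIntegral.integral_const, smul_eq_mul, mul_neg_one,
      ← abs_of_nonpos (sub_nonpos.2 h)] at h1

variable {α : Type*} [MeasurableSpace α] {μ : Measure α} {a w w' : α → ℝ}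

theorem integrable_entropy (hS : Continuous S) (hβ : Continuous β) (hg : Continuous g)
    (hS1 : ∀ y, |S y| ≤ 1) (ha : AEStronglyMeasurable a μ) (hga : Integrable (fun x => g (a x)) μ)
    (hw : Integrable w μ) : Integrable (fun x => entropy S β g (a x) (w x)) μ :=
  (hw.sub hga).mono ((continuous_entropy hS hβ hg).comp_aestronglyMeasurable (ha.prodMk hw.1))
    (ae_of_all _ fun _ => abs_entropy_le hS hβ hS1 _ _)

theorem abs_integral_entropy_sub_le (hS : Continuous S) (hβ : Continuous β) (hg : Continuous g)
    (hS1 : ∀ y, |S y| ≤ 1) (ha : AEStronglyMeasurable a μ) (hga : Integrable (fun x => g (a x)) μ)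
    (hw : Integrable w μ) (hw' : Integrable w' μ) :
    |∫ x, entropy S β g (a x) (w' x) ∂μ - ∫ x, entropy S β g (a x) (w x) ∂μ|
      ≤ ∫ x, |w' x - w x| ∂μ := by
  rw [← integral_sub (integrable_entropy hS hβ hg hS1 ha hga hw')
    (integrable_entropy hS hβ hg hS1 ha hga hw)]
  rw [← Real.norm_eq_abs]
  refine norm_integral_le_of_norm_le (g := fun x => |w' x - w x|) (hw'.sub hw).abs
    (ae_of_all _ fun x => ?_)
  exact abs_entropy_sub_le hS hβ hS1 _ _ _

theorem integral_mul_sub_le_integral_entropy_sub (hS : Continuous S) (hβ : Continuous β)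
    (hg : Continuous g) (hS1 : ∀ y, |S y| ≤ 1) (hSm : Monotone S) (hβm : Monotone β)
    (ha : AEStronglyMeasurable a μ) (hga : Integrable (fun x => g (a x)) μ)
    (hw : Integrable w μ) (hw' : Integrable w' μ) :
    ∫ x, S (β (w x) - a x) * (w' x - w x) ∂μ
      ≤ ∫ x, entropy S β g (a x) (w' x) ∂μ - ∫ x, entropy S β g (a x) (w x) ∂μ := by
  have h1 := integrable_entropy (β := β) hS hβ hg hS1 ha hga hw
  have h2 := integrable_entropy (β := β) hS hβ hg hS1 ha hga hw'
  rw [← integral_sub h2 h1]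
  refine integral_mono ?_ (h2.sub h1) fun x => le_entropy_sub hS hβ hSm hβm _ _ _
  refine (hw'.sub hw).bdd_mul (c := 1) ?_ (ae_of_all _ fun _ => hS1 _)
  exact hS.comp_aestronglyMeasurable ((hβ.comp_aestronglyMeasurable hw.1).sub ha)

theorem tendsto_integral_entropy_smoothSign (hβ : Continuous β) (hg : Continuous g)
    (hβm : StrictMono β) (hβg : ∀ y, β (g y) = y)
    (ha : AEStronglyMeasurable a μ) (hga : Integrable (fun x => g (a x)) μ)
    (hw : Integrable w μ) :
    Tendsto (fun n => ∫ x, entropy (smoothSign n) β g (a x) (w x) ∂μ) atTop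
      (𝓝 (∫ x, |w x - g (a x)| ∂μ)) :=
  tendsto_integral_of_dominated_convergence (fun x => |w x - g (a x)|)
    (fun n => (integrable_entropy (continuous_smoothSign n) hβ hg (abs_smoothSign_le_one n)
      ha hga hw).1) (hw.sub hga).abs
    (fun n => ae_of_all _ fun _ =>
      abs_entropy_le (continuous_smoothSign n) hβ (abs_smoothSign_le_one n) _ _)
    (ae_of_all _ fun _ => tendsto_entropy_smoothSign hβ hβm _ _ (hβg _))

end Entropy

/-! ### Hölder duality -/

section Duality

variable {α : Type*} [MeasurableSpace α] {μ : Measure α} {p q : ℝ≥0∞}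

instance fact_one_le_conjExponent (p : ℝ≥0∞) : Fact (1 ≤ ENNReal.conjExponent p) :=
  ⟨le_self_add⟩

theorem integrable_mul_of_holderConjugate (hpq : p.HolderConjugate q) (F : Lp ℝ q μ)
    (g : Lp ℝ p μ) : Integrable (fun x => F x * g x) μ :=
  memLp_one_iff_integrable.1 ((Lp.memLp g).mul (p := q) (q := p) (Lp.memLp F))

theorem abs_integral_mul_le_of_holderConjugate [Fact (1 ≤ p)] [Fact (1 ≤ q)] 
    (hpq : p.HolderConjugate q) (F : Lp ℝ q μ) (g : Lp ℝ p μ) :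
    |∫ x, F x * g x ∂μ| ≤ ‖F‖ * ‖g‖ := by
  have h1 := eLpNorm_smul_le_mul_eLpNorm (p := q) (q := p) (r := 1) (Lp.memLp g).1 (Lp.memLp F).1
  rw [eLpNorm_one_eq_lintegral_enorm] at h1
  have h2 : ‖∫ x, F x * g x ∂μ‖ₑ ≤ ‖F‖ₑ * ‖g‖ₑ := by
    rw [Lp.enorm_def, Lp.enorm_def]
    exact (enorm_integral_le_lintegral_enorm _).trans h1
  rw [← enorm_norm F, ← enorm_norm g, ← enorm_mul, enorm_le_iff_norm_le] at h2
  simpa using h2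

end Duality

/-! ### Sobolev functions on the graph -/

namespace CompactMetricGraph

variable {V E : Type*} [Fintype V] [Fintype E] {G : CompactMetricGraph V E}

/-- An edge has two distinct ends, so a connected graph with an edge has no isolated vertex. This
matters because `Sobolev.vertexValue` is a choice that is determined only at the ends of edges. -/
theorem exists_edge_of_connected [Nonempty E] (hG : G.Connected) (a : V) :
    ∃ e, G.init e = a ∨ G.term e = a := by
  obtain ⟨e₀⟩ := ‹Nonempty E›
  have : Nontrivial V := ⟨_, _, G.no_loop e₀⟩
  obtain ⟨b, hb⟩ := SimpleGraph.Preconnected.exists_adj_of_nontrivial hG.preconnected a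
  rw [SimpleGraph.fromRel_adj] at hb
  rcases hb.2 with ⟨e, h1, -⟩ | ⟨e, -, h2⟩
  · exact ⟨e, Or.inl h1⟩
  · exact ⟨e, Or.inr h2⟩

section

variable {q : E → ℝ≥0∞} [∀ e, Fact (1 ≤ q e)]

/-- The pair with given components. -/
noncomputable def PairSpace.mk (a b : E → ℝ → ℝ) (ha : ∀ e, MemLp (a e) (q e) (G.edgeMeasure e))
    (hb : ∀ e, MemLp (b e) (q e) (G.edgeMeasure e)) : G.PairSpace q :=
  WithLp.toLp 1 fun e => WithLp.toLp (q e) ((ha e).toLp _, (hb e).toLp _)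

theorem PairSpace.fn_mk (a b : E → ℝ → ℝ) (ha : ∀ e, MemLp (a e) (q e) (G.edgeMeasure e))
    (hb : ∀ e, MemLp (b e) (q e) (G.edgeMeasure e)) (e : E) :
    (PairSpace.mk a b ha hb).fn e =ᵐ[G.edgeMeasure e] a e :=
  (ha e).coeFn_toLp

theorem PairSpace.der_mk (a b : E → ℝ → ℝ) (ha : ∀ e, MemLp (a e) (q e) (G.edgeMeasure e))
    (hb : ∀ e, MemLp (b e) (q e) (G.edgeMeasure e)) (e : E) :
    (PairSpace.mk a b ha hb).der e =ᵐ[G.edgeMeasure e] b e :=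
  (hb e).coeFn_toLp

theorem Sobolev.integrable_fn (u : G.Sobolev q) (e : E) :
    Integrable (Sobolev.fn u e) (G.edgeMeasure e) :=
  PairSpace.integrable_fn _ e

theorem Sobolev.integrable_der (u : G.Sobolev q) (e : E) :
    Integrable (Sobolev.der u e) (G.edgeMeasure e) :=
  PairSpace.integrable_der _ e

theorem Sobolev.memLp_fn (u : G.Sobolev q) (e : E) :
    MemLp (Sobolev.fn u e) (q e) (G.edgeMeasure e) :=
  Lp.memLp _

theorem Sobolev.memLp_der (u : G.Sobolev q) (e : E) :
    MemLp (Sobolev.der u e) (q e) (G.edgeMeasure e) :=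
  Lp.memLp _

/-- A function in `𝒲^{1,q}(G)` with prescribed components and vertex values. -/
theorem Sobolev.exists_mk (r g : E → ℝ → ℝ) (hr : ∀ e, ContinuousOn (r e) (Icc 0 (G.length e)))
    (hg : ∀ e, MemLp (g e) (q e) (G.edgeMeasure e))
    (hrg : ∀ e, HasWeakDeriv 0 (G.length e) (r e) (g e)) (c : V → ℝ)
    (h0 : ∀ e, r e 0 = c (G.init e)) (h1 : ∀ e, r e (G.length e) = c (G.term e)) :
    ∃ φ : G.Sobolev q, (∀ e, Sobolev.fn φ e =ᵐ[G.edgeMeasure e] r e) ∧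
      (∀ e, Sobolev.der φ e =ᵐ[G.edgeMeasure e] g e) ∧
      HasVertexValues (φ : G.PairSpace q) c := by
  have hr' : ∀ e, MemLp (r e) (q e) (G.edgeMeasure e) := fun e => by
    obtain ⟨C, hC⟩ := isCompact_Icc.exists_bound_of_continuousOn (hr e)
    refine MemLp.of_bound ?_ C ?_
    · exact ((hr e).mono Ioo_subset_Icc_self).aestronglyMeasurable measurableSet_Ioo
    · rw [ae_restrict_iff' measurableSet_Ioo]
      exact ae_of_all _ fun x hx => hC x (Ioo_subset_Icc_self hx)
  have hv : HasVertexValues (PairSpace.mk r g hr' hg) c := fun e =>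
    ⟨r e, hr e, PairSpace.fn_mk r g hr' hg e, h0 e, h1 e⟩
  refine ⟨⟨PairSpace.mk r g hr' hg, fun e => ?_, c, hv⟩, PairSpace.fn_mk r g hr' hg,
    PairSpace.der_mk r g hr' hg, hv⟩
  exact (hrg e).congr (PairSpace.fn_mk r g hr' hg e).symm (PairSpace.der_mk r g hr' hg e).symm

/-- The continuous representatives of a function in `𝒲^{1,q}(G)` are primitives. -/
theorem Sobolev.exists_representative (u : G.Sobolev q) (e : E) : ∃ c : ℝ,
    Sobolev.fn u e =ᵐ[G.edgeMeasure e] (fun x => c + ∫ t in (0 : ℝ)..x, Sobolev.der u e t) ∧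
    ContinuousOn (fun x => c + ∫ t in (0 : ℝ)..x, Sobolev.der u e t) (Icc 0 (G.length e)) ∧
    c + ∫ t in (0 : ℝ)..0, Sobolev.der u e t = Sobolev.vertexValue u (G.init e) ∧
    c + ∫ t in (0 : ℝ)..G.length e, Sobolev.der u e t = Sobolev.vertexValue u (G.term e) := by
  have hl := G.length_pos e
  obtain ⟨c, hc⟩ := (u.2.1 e).exists_primitive hl (Sobolev.integrable_fn u e)
    (Sobolev.integrable_der u e)
  have hcont := (absolutelyContinuousOnInterval_primitive hl.le
    (Sobolev.integrable_der u e) c).continuousOn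
  rw [uIcc_of_le hl.le] at hcont
  obtain ⟨r, hr, hr1, hr2, hr3⟩ := Sobolev.hasVertexValues u e
  -- Continuous functions that agree a.e. agree on the closed interval; in particular the primitive
  -- takes the vertex values at the ends.
  have h : EqOn (fun x => c + ∫ t in (0 : ℝ)..x, Sobolev.der u e t) r (Icc 0 (G.length e)) :=
    Measure.eqOn_Icc_of_ae_eq (μ := volume) hl.ne (by
      rw [← restrict_Ioo_eq_restrict_Icc]
      exact hc.symm.trans hr1) hcont hr
  exact ⟨c, hc, hcont, by rw [← hr2]; exact h (left_mem_Icc.2 hl.le),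
    by rw [← hr3]; exact h (right_mem_Icc.2 hl.le)⟩

/-- The composition of a function in `𝒲^{1,q}(G)` with a Lipschitz function of class `C¹`. -/
theorem Sobolev.exists_comp (w : G.Sobolev q) {S S' : ℝ → ℝ} {K : NNReal}
    (hS : LipschitzWith K S) (hS' : ∀ y, HasDerivAt S (S' y) y) (hS'c : Continuous S')
    (hK : ∀ y, |S' y| ≤ K) :
    ∃ φ : G.Sobolev q, (∀ e, Sobolev.fn φ e =ᵐ[G.edgeMeasure e] fun x => S (Sobolev.fn w e x)) ∧
      (∀ e, Sobolev.der φ e =ᵐ[G.edgeMeasure e]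
        fun x => S' (Sobolev.fn w e x) * Sobolev.der w e x) ∧
      HasVertexValues (φ : G.PairSpace q) fun a => S (Sobolev.vertexValue w a) := by
  choose c hc hcont h0 h1 using Sobolev.exists_representative w
  have hd : ∀ e, (fun x => S' (Sobolev.fn w e x) * Sobolev.der w e x) =ᵐ[G.edgeMeasure e]
      fun x => S' (c e + ∫ t in (0 : ℝ)..x, Sobolev.der w e t) * Sobolev.der w e x := fun e => by
    filter_upwards [hc e] with x hx
    rw [hx]
  have hm : ∀ e, MemLp (fun x => S' (c e + ∫ t in (0 : ℝ)..x, Sobolev.der w e t)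
      * Sobolev.der w e x) (q e) (G.edgeMeasure e) := fun e => by
    refine (memLp_congr_ae (hd e)).1 ?_
    refine MemLp.of_le_mul (c := K) (Sobolev.memLp_der w e) ?_ (ae_of_all _ fun x => ?_)
    · exact (hS'c.comp_aestronglyMeasurable (Sobolev.memLp_fn w e).1).mul (Sobolev.memLp_der w e).1
    · rw [norm_mul]
      exact mul_le_mul_of_nonneg_right (hK _) (norm_nonneg _)
  obtain ⟨φ, hφ1, hφ2, hφ3⟩ := Sobolev.exists_mk
    (fun e x => S (c e + ∫ t in (0 : ℝ)..x, Sobolev.der w e t)) _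
    (fun e => hS.continuous.comp_continuousOn (hcont e)) hm
    (fun e => hasWeakDeriv_comp_primitive (G.length_pos e).le (Sobolev.integrable_der w e) (c e)
      hS hS') (fun a => S (Sobolev.vertexValue w a)) (fun e => congrArg S (h0 e))
    (fun e => congrArg S (h1 e))
  refine ⟨φ, fun e => (hφ1 e).trans ?_, fun e => (hφ2 e).trans (hd e).symm, hφ3⟩
  filter_upwards [hc e] with x hx
  rw [hx]

theorem Sobolev.vertexValue_eq (u : G.Sobolev q) {c : V → ℝ}
    (hc : HasVertexValues (u : G.PairSpace q) c) {a : V} (ha : ∃ e, G.init e = a ∨ G.term e = a) :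
    Sobolev.vertexValue u a = c a := by
  obtain ⟨e, rfl | rfl⟩ := ha
  · exact (Sobolev.vertexValue_unique u hc e).1
  · exact (Sobolev.vertexValue_unique u hc e).2

/-- Continuity on the compact edges gives boundedness, which makes the pairing with `L¹(G)` finite.
-/
theorem Sobolev.exists_bound (u : G.Sobolev q) :
    ∃ C, ∀ e, ∀ᵐ x ∂(G.edgeMeasure e), |Sobolev.fn u e x| ≤ C := by
  have h : ∀ e, ∃ C, ∀ᵐ x ∂(G.edgeMeasure e), |Sobolev.fn u e x| ≤ C := fun e => by
    obtain ⟨r, hr, hr1, -⟩ := Sobolev.hasVertexValues u e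
    obtain ⟨C, hC⟩ := isCompact_Icc.exists_bound_of_continuousOn hr
    refine ⟨C, ?_⟩
    filter_upwards [hr1, ae_restrict_mem measurableSet_Ioo] with x hx hx'
    change |(u : G.PairSpace q).fn e x| ≤ C
    rw [hx]
    exact hC x (Ioo_subset_Icc_self hx')
  choose C hC using h
  refine ⟨∑ e, |C e|, fun e => (hC e).mono fun x hx => hx.trans ((le_abs_self _).trans ?_)⟩
  exact Finset.single_le_sum (f := fun e => |C e|) (fun _ _ => abs_nonneg _) (Finset.mem_univ e)

/-- `𝒲^{1,q}(G) ⊆ 𝒲^{1,1}(G)`. -/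
theorem Sobolev.exists_sobolevOne (u : G.Sobolev q) : ∃ φ : G.SobolevOne,
    (∀ e, Sobolev.fn φ e =ᵐ[G.edgeMeasure e] Sobolev.fn u e) ∧
      HasVertexValues (φ : G.PairSpace fun _ => 1) (Sobolev.vertexValue u) := by
  choose c hc hcont h0 h1 using Sobolev.exists_representative u
  obtain ⟨φ, hφ1, -, hφ3⟩ := Sobolev.exists_mk (G := G) (q := fun _ => 1) _ _ hcont
    (fun e => memLp_one_iff_integrable.2 (Sobolev.integrable_der u e))
    (fun e => HasWeakDeriv.congr (u.2.1 e) (hc e) EventuallyEq.rfl) (Sobolev.vertexValue u) h0 h1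
  exact ⟨φ, fun e => (hφ1 e).trans (hc e).symm, hφ3⟩

theorem Sobolev.fn_sub (u w : G.Sobolev q) (e : E) :
    Sobolev.fn (u - w) e =ᵐ[G.edgeMeasure e] fun x => Sobolev.fn u e x - Sobolev.fn w e x :=
  Lp.coeFn_sub (((u : G.PairSpace q)) e).fst ((w : G.PairSpace q) e).fst

theorem Sobolev.der_sub (u w : G.Sobolev q) (e : E) :
    Sobolev.der (u - w) e =ᵐ[G.edgeMeasure e] fun x => Sobolev.der u e x - Sobolev.der w e x :=
  Lp.coeFn_sub (((u : G.PairSpace q)) e).snd ((w : G.PairSpace q) e).snd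

/-! ### The pairing with integrable functions -/

theorem integrable_mul_fn (v : G.L1) (φ : G.Sobolev q) (e : E) :
    Integrable (fun x => v e x * Sobolev.fn φ e x) (G.edgeMeasure e) := by
  obtain ⟨C, hC⟩ := Sobolev.exists_bound φ
  exact (L1.integrable_coeFn (v e)).mul_bdd (c := C) (Sobolev.integrable_fn φ e).1 (hC e)

theorem pairing_add (v w : G.L1) (φ : G.Sobolev q) :
    G.pairing (v + w) φ = G.pairing v φ + G.pairing w φ := by
  simp only [pairing, ← Finset.sum_add_distrib]
  refine Finset.sum_congr rfl fun e _ => ?_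
  rw [← integral_add (integrable_mul_fn v φ e) (integrable_mul_fn w φ e)]
  refine integral_congr_ae ?_
  filter_upwards [Lp.coeFn_add (v e) (w e)] with x hx
  change (v e + w e : Lp ℝ 1 (G.edgeMeasure e)) x * _ = _
  rw [hx, Pi.add_apply, add_mul]

theorem pairing_smul (c : ℝ) (v : G.L1) (φ : G.Sobolev q) :
    G.pairing (c • v) φ = c * G.pairing v φ := by
  simp only [pairing, Finset.mul_sum, ← integral_const_mul]
  refine Finset.sum_congr rfl fun e _ => integral_congr_ae ?_
  filter_upwards [Lp.coeFn_smul c (v e)] with x hx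
  change (c • v e : Lp ℝ 1 (G.edgeMeasure e)) x * _ = _
  rw [hx, Pi.smul_apply, smul_eq_mul, mul_assoc]

theorem abs_pairing_le (v : G.L1) (φ : G.Sobolev q) {C : ℝ}
    (hC : ∀ e, ∀ᵐ x ∂(G.edgeMeasure e), |Sobolev.fn φ e x| ≤ C) :
    |G.pairing v φ| ≤ C * ‖v‖ := by
  rw [PiLp.norm_eq_of_L1, Finset.mul_sum]
  refine (Finset.abs_sum_le_sum_abs _ _).trans (Finset.sum_le_sum fun e _ => ?_)
  rw [L1.norm_eq_integral_norm, ← integral_const_mul, ← Real.norm_eq_abs]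
  refine norm_integral_le_of_norm_le ((L1.integrable_coeFn (v e)).norm.const_mul C) ?_
  filter_upwards [hC e] with x hx
  rw [norm_mul, mul_comm]
  exact mul_le_mul_of_nonneg_right hx (norm_nonneg _)

/-- The pairing with a fixed function in `𝒲^{1,q}(G)`, as a continuous linear form on `L¹(G)`. -/
noncomputable def pairingCLM (φ : G.Sobolev q) : G.L1 →L[ℝ] ℝ :=
  LinearMap.mkContinuous
    { toFun := fun v => G.pairing v φ
      map_add' := fun v w => pairing_add v w φ
      map_smul' := fun c v => pairing_smul c v φ } (Sobolev.exists_bound φ).choose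
    fun v => abs_pairing_le v φ (Sobolev.exists_bound φ).choose_spec

theorem pairingCLM_apply (v : G.L1) (φ : G.Sobolev q) : pairingCLM φ v = G.pairing v φ := rfl

end

end CompactMetricGraph

namespace CompactMetricGraph

variable {V E : Type*} [Fintype V] [Fintype E] {G : CompactMetricGraph V E}
  {p : E → ℝ≥0∞} [∀ e, Fact (1 ≤ p e)]

/-! ### The flux `|u'|^{p-2} u'` -/

/-- `|[u]ₑ'|^{pₑ-2} [u]ₑ'`, as an element of the dual space of `L^{pₑ}(0, ℓₑ)`. -/
noncomputable def flux (hp : ∀ e, 1 < p e) (hp_top : ∀ e, p e < ∞) (u : G.Sobolev p) (e : E) :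
    Lp ℝ (ENNReal.conjExponent (p e)) (G.edgeMeasure e) :=
  nemytskii (hp e) (hp_top e) inferInstance ((u : G.PairSpace p) e).snd

theorem coeFn_flux (hp : ∀ e, 1 < p e) (hp_top : ∀ e, p e < ∞) (u : G.Sobolev p) (e : E) :
    flux hp hp_top u e =ᵐ[G.edgeMeasure e]
      fun x => signedPow (p e).toReal (Sobolev.der u e x) :=
  coeFn_nemytskii _ _ _ _

theorem integrable_flux_mul_der (hp : ∀ e, 1 < p e) (hp_top : ∀ e, p e < ∞) (u φ : G.Sobolev p)
    (e : E) : Integrable (fun x => signedPow (p e).toReal (Sobolev.der u e x) * Sobolev.der φ e x)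
      (G.edgeMeasure e) := by
  refine (integrable_mul_of_holderConjugate inferInstance (flux hp hp_top u e)
    ((φ : G.PairSpace p) e).snd).congr ?_
  filter_upwards [coeFn_flux hp hp_top u e] with x hx
  rw [hx]
  rfl

/-- The duality pairing with `[φ]ₑ'`. -/
noncomputable def derCLM (φ : G.Sobolev p) (e : E) :
    Lp ℝ (ENNReal.conjExponent (p e)) (G.edgeMeasure e) →L[ℝ] ℝ :=
  LinearMap.mkContinuous
    { toFun := fun F => ∫ x, F x * Sobolev.der φ e x ∂(G.edgeMeasure e)
      map_add' := fun F F' => by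
        refine (integral_congr_ae ?_).trans (integral_add
          (integrable_mul_of_holderConjugate inferInstance F ((φ : G.PairSpace p) e).snd)
          (integrable_mul_of_holderConjugate inferInstance F' ((φ : G.PairSpace p) e).snd))
        filter_upwards [Lp.coeFn_add F F'] with x hx
        rw [hx, Pi.add_apply, add_mul]
      map_smul' := fun c F => by
        rw [RingHom.id_apply, smul_eq_mul, ← integral_const_mul]
        refine integral_congr_ae ?_
        filter_upwards [Lp.coeFn_smul c F] with x hx
        rw [hx, Pi.smul_apply, smul_eq_mul, mul_assoc] } ‖((φ : G.PairSpace p) e).snd‖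
    fun F => (abs_integral_mul_le_of_holderConjugate inferInstance F _).trans_eq (mul_comm _ _)

theorem abs_derCLM_le (φ : G.Sobolev p) (e : E)
    (F : Lp ℝ (ENNReal.conjExponent (p e)) (G.edgeMeasure e)) :
    |derCLM φ e F| ≤ ‖((φ : G.PairSpace p) e).snd‖ * ‖F‖ :=
  (abs_integral_mul_le_of_holderConjugate inferInstance F ((φ : G.PairSpace p) e).snd).trans_eq
    (mul_comm _ _)

/-- The form is linear and continuous in the flux, so its integrability in time and its differences
are read off from the flux. -/
theorem pLaplaceForm_eq_sum (hp : ∀ e, 1 < p e) (hp_top : ∀ e, p e < ∞) (u φ : G.Sobolev p) :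
    G.pLaplaceForm p u φ = ∑ e, derCLM φ e (flux hp hp_top u e) := by
  refine Finset.sum_congr rfl fun e _ => integral_congr_ae ?_
  filter_upwards [coeFn_flux hp hp_top u e] with x hx
  rw [hx]
  rfl

/-- The monotonicity of the `p`-Laplacian. -/
theorem pLaplaceForm_le (hp : ∀ e, 1 < p e) (hp_top : ∀ e, p e < ∞) (u w φ : G.Sobolev p)
    (k : E → ℝ → ℝ) (hk : ∀ e x, 0 ≤ k e x)
    (hφ : ∀ e, Sobolev.der φ e =ᵐ[G.edgeMeasure e]
      fun x => k e x * (Sobolev.der u e x - Sobolev.der w e x)) :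
    G.pLaplaceForm p w φ ≤ G.pLaplaceForm p u φ := by
  refine Finset.sum_le_sum fun e _ => ?_
  have hr : 1 < (p e).toReal := by
    rw [← ENNReal.toReal_one]
    exact (ENNReal.toReal_lt_toReal (by simp) (hp_top e).ne).2 (hp e)
  refine integral_mono_ae (integrable_flux_mul_der hp hp_top w φ e)
    (integrable_flux_mul_der hp hp_top u φ e) ?_
  filter_upwards [hφ e] with x hx
  change signedPow _ _ * _ ≤ signedPow _ _ * _
  rw [hx]
  have hm := signedPow_mono hr
  -- In both orders the difference of the fluxes and the difference of the derivatives have the same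
  -- sign.
  rcases le_total (Sobolev.der u e x) (Sobolev.der w e x) with h | h
  · nlinarith [mul_nonneg (hk e x) (mul_nonneg (sub_nonneg.2 (hm h)) (sub_nonneg.2 h))]
  · nlinarith [mul_nonneg (hk e x) (mul_nonneg (sub_nonneg.2 (hm h)) (sub_nonneg.2 h))]

theorem memLp_der_time {T : ℝ} {u : ℝ → G.Sobolev p} (hu : G.MemLpTime T u) (e : E) :
    MemLp (fun t => ((u t : G.PairSpace p) e).snd) (p e) (volume.restrict (Ioo 0 T)) :=
  (hu.2 e).of_le (WithLp.continuous_snd _ _ _ |>.comp_aestronglyMeasurable (hu.2 e).1)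
    (ae_of_all _ fun _ => WithLp.norm_snd_le _ _)

/-- The dual norm of the flux is `‖u(t)'‖^{p-1}`, so the identity `(p - 1) q = p`, already used in
space, applies to the scalar function `t ↦ ‖u(t)'‖` as well. -/
theorem memLp_flux_time (hp : ∀ e, 1 < p e) (hp_top : ∀ e, p e < ∞) {T : ℝ} {u : ℝ → G.Sobolev p}
    (hu : G.MemLpTime T u) (e : E) :
    MemLp (fun t => flux hp hp_top (u t) e) (ENNReal.conjExponent (p e))
      (volume.restrict (Ioo 0 T)) := by
  have hr : 1 < (p e).toReal := by
    rw [← ENNReal.toReal_one]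
    exact (ENNReal.toReal_lt_toReal (by simp) (hp_top e).ne).2 (hp e)
  have h := memLp_der_time hu e
  refine (h.norm.signedPow (hp e) (hp_top e)
    (inferInstance : (p e).HolderConjugate (ENNReal.conjExponent (p e)))).congr_norm
    ((continuous_nemytskii _ _ _).comp_aestronglyMeasurable h.1) (ae_of_all _ fun t => ?_)
  have h1 := congrArg ENNReal.toReal (enorm_nemytskii (hp e) (hp_top e)
    (inferInstance : (p e).HolderConjugate (ENNReal.conjExponent (p e)))
    ((u t : G.PairSpace p) e).snd)
  rw [← ENNReal.toReal_rpow, toReal_enorm, toReal_enorm] at h1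
  rw [Real.norm_eq_abs, abs_signedPow hr, abs_norm]
  exact h1.symm

/-! ### The evolution equation, tested with functions of the space variable -/

/-- The right-hand side of the equation, with the `p`-Laplacian, tested with `φ`. -/
noncomputable def sourceTerm (f : G.L1) (ω : G.VertexL1) (u φ : G.Sobolev p) : ℝ :=
  G.pairing f φ + ∑ a, ω a * Sobolev.vertexValue φ a - G.pLaplaceForm p u φ

theorem integrable_pLaplaceForm (hp : ∀ e, 1 < p e) (hp_top : ∀ e, p e < ∞) {T : ℝ}
    {u : ℝ → G.Sobolev p} (hu : G.MemLpTime T u) (φ : G.Sobolev p) :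
    IntegrableOn (fun t => G.pLaplaceForm p (u t) φ) (Ioo 0 T) := by
  simp only [pLaplaceForm_eq_sum hp hp_top]
  exact integrable_finsetSum _ fun e _ => (derCLM φ e).integrable_comp
    ((memLp_flux_time hp hp_top hu e).integrable Fact.out)

theorem integrable_pairing {T : ℝ} {f : ℝ → G.L1} (hf : IntegrableOn f (Ioo 0 T))
    (φ : G.Sobolev p) : IntegrableOn (fun t => G.pairing (f t) φ) (Ioo 0 T) :=
  (pairingCLM φ).integrable_comp hf

theorem integrable_vertex {T : ℝ} {ω : ℝ → G.VertexL1} (hω : IntegrableOn ω (Ioo 0 T)) (a : V) :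
    IntegrableOn (fun t => ω t a) (Ioo 0 T) :=
  (PiLp.proj 1 (fun _ : V => ℝ) a : G.VertexL1 →L[ℝ] ℝ).integrable_comp hω

theorem integrable_sourceTerm (hp : ∀ e, 1 < p e) (hp_top : ∀ e, p e < ∞) {T : ℝ}
    {f : ℝ → G.L1} (hf : IntegrableOn f (Ioo 0 T)) {ω : ℝ → G.VertexL1}
    (hω : IntegrableOn ω (Ioo 0 T)) {u : ℝ → G.Sobolev p} (hu : G.MemLpTime T u)
    (φ : G.Sobolev p) : IntegrableOn (fun t => sourceTerm (f t) (ω t) (u t) φ) (Ioo 0 T) :=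
  ((integrable_pairing hf φ).add (integrable_finsetSum _ fun a _ =>
    (integrable_vertex hω a).mul_const _)).sub (integrable_pLaplaceForm hp hp_top hu φ)

theorem pLaplaceForm_smul (u φ : G.Sobolev p) (c : ℝ) :
    G.pLaplaceForm p u (c • φ) = c * G.pLaplaceForm p u φ := by
  simp only [pLaplaceForm, Finset.mul_sum, ← integral_const_mul]
  refine Finset.sum_congr rfl fun e _ => integral_congr_ae ?_
  filter_upwards [PairSpace.der_smul c (φ : G.PairSpace p) e] with x hx
  change _ * ((c • (φ : G.PairSpace p)).der e x) = _
  rw [hx]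
  change _ * (c * Sobolev.der φ e x) = _
  ring

theorem pairing_smul_right (v : G.L1) (φ : G.Sobolev p) (c : ℝ) :
    G.pairing v (c • φ) = c * G.pairing v φ := by
  simp only [pairing, Finset.mul_sum, ← integral_const_mul]
  refine Finset.sum_congr rfl fun e _ => integral_congr_ae ?_
  filter_upwards [PairSpace.fn_smul c (φ : G.PairSpace p) e] with x hx
  change _ * ((c • (φ : G.PairSpace p)).fn e x) = _
  rw [hx]
  change _ * (c * Sobolev.fn φ e x) = _
  ring

theorem pairing_congr {q : E → ℝ≥0∞} [∀ e, Fact (1 ≤ q e)] (v : G.L1) (φ : G.Sobolev p)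
    (ψ : G.Sobolev q) (h : ∀ e, Sobolev.fn ψ e =ᵐ[G.edgeMeasure e] Sobolev.fn φ e) :
    G.pairing v ψ = G.pairing v φ := by
  refine Finset.sum_congr rfl fun e _ => integral_congr_ae ?_
  filter_upwards [h e] with x hx
  rw [hx]

/-- Products of a test function in time and a function in `𝒲^{1,p}(G)` are admissible. -/
theorem isEvolutionTest_smul {T : ℝ} (hT : 0 < T) {θ : ℝ → ℝ} (hθ : IsScalarTest 0 T θ)
    (φ : G.Sobolev p) (φ₁ : G.SobolevOne)
    (h : ∀ e, Sobolev.fn φ₁ e =ᵐ[G.edgeMeasure e] Sobolev.fn φ e) :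
    G.IsEvolutionTest T (fun t => θ t • φ₁) (fun t => deriv θ t • φ₁) (fun t => θ t • φ) where
  continuousOn := (hθ.smooth.continuous.smul continuous_const).continuousOn
  integrable_deriv := (((hθ.continuous_deriv).smul continuous_const).continuousOn.integrableOn_Icc
    (a := 0) (b := T)).mono_set Ioo_subset_Icc_self
  hasWeakDeriv := by
    intro η hη
    -- The scalar identity `∫ (η θ)' = 0` suffices, since the constant vector `φ₁` factors out.
    have h1 := (hη.mul hθ).integral_deriv hT.le
    have hone : IntegrableOn (fun _ : ℝ => (1 : ℝ)) (Ioo 0 T) := by simp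
    have hd : ∀ t, deriv (fun x => η x * θ x) t = deriv η t * θ t + η t * deriv θ t := fun t =>
      deriv_fun_mul (hη.differentiable t) (hθ.differentiable t)
    have hi1 : IntegrableOn (fun t => deriv η t * θ t) (Ioo 0 T) :=
      ((hη.continuous_deriv.mul hθ.smooth.continuous).integrableOn_Icc (a := 0)
        (b := T)).mono_set Ioo_subset_Icc_self
    have hi2 : IntegrableOn (fun t => η t * deriv θ t) (Ioo 0 T) :=
      ((hη.smooth.continuous.mul hθ.continuous_deriv).integrableOn_Icc (a := 0)
        (b := T)).mono_set Ioo_subset_Icc_self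
    simp only [hd] at h1
    rw [integral_add hi1 hi2] at h1
    simp only [Submodule.coe_smul, smul_smul]
    rw [integral_smul_const, integral_smul_const, ← neg_smul]
    congr 1
    linarith
  memLp := by
    refine ⟨((hθ.smooth.continuous.smul continuous_const).continuousOn.integrableOn_Icc
      (a := 0) (b := T)).mono_set Ioo_subset_Icc_self, fun e => ?_⟩
    obtain ⟨C, hC⟩ := hθ.compact.exists_bound_of_continuous hθ.smooth.continuous
    have hc : Continuous fun t => ((θ t • φ : G.Sobolev p) : G.PairSpace p) e :=
      (hθ.smooth.continuous.smul continuous_const :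
        Continuous fun t => θ t • ((φ : G.PairSpace p) e))
    refine MemLp.of_bound hc.aestronglyMeasurable (C * ‖(φ : G.PairSpace p) e‖)
      (ae_of_all _ fun t => ?_)
    change ‖θ t • ((φ : G.PairSpace p) e)‖ ≤ _
    rw [norm_smul]
    exact mul_le_mul_of_nonneg_right (hC t) (norm_nonneg _)
  same := ae_of_all _ fun t e => by
    filter_upwards [h e, PairSpace.fn_smul (θ t) (φ : G.PairSpace p) e,
      PairSpace.fn_smul (θ t) (φ₁ : G.PairSpace fun _ => 1) e] with x h1 h2 h3
    exact h2.trans ((congrArg (θ t * ·) h1.symm).trans h3.symm)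
  zero_left := by simp [hθ.eq_zero (x := 0) (by simp)]
  zero_right := by simp [hθ.eq_zero (x := T) (by simp)]

end CompactMetricGraph

namespace CompactMetricGraph

variable {V E : Type*} [Fintype V] [Fintype E] {G : CompactMetricGraph V E}
  {p : E → ℝ≥0∞} [∀ e, Fact (1 ≤ p e)]

theorem HasVertexValues.smul {u : G.PairSpace p} {c : V → ℝ} (h : HasVertexValues u c) (a : ℝ) :
    HasVertexValues (a • u) fun x => a * c x := by
  intro e
  obtain ⟨r, hr, hr1, hr2, hr3⟩ := h e
  refine ⟨fun x => a * r x, continuousOn_const.mul hr, ?_, congrArg (a * ·) hr2,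
    congrArg (a * ·) hr3⟩
  filter_upwards [u.fn_smul a e, hr1] with x h1 h2
  rw [h1, h2]

/-- The equation is tested with the products `θ(t) φ(x)`, and `θ(t)` is taken out of every term. -/
theorem hasWeakDeriv_pairing (hp : ∀ e, 1 < p e) (hp_top : ∀ e, p e < ∞)
    (hE : ∀ a, ∃ e, G.init e = a ∨ G.term e = a) {T : ℝ} (hT : 0 < T)
    {f : ℝ → G.L1} (hf : IntegrableOn f (Ioo 0 T)) {ω : ℝ → G.VertexL1}
    (hω : IntegrableOn ω (Ioo 0 T)) {u : ℝ → G.Sobolev p} (hu : G.MemLpTime T u) {v : ℝ → G.L1}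
    (heq : ∀ (ψ ψ' : ℝ → G.SobolevOne) (ψp : ℝ → G.Sobolev p), G.IsEvolutionTest T ψ ψ' ψp →
      - (∫ t in Ioo 0 T, G.pairing (v t) (ψ' t)) + ∫ t in Ioo 0 T, G.pLaplaceForm p (u t) (ψp t)
        = (∫ t in Ioo 0 T, G.pairing (f t) (ψ t))
          + ∑ a, ∫ t in Ioo 0 T, ω t a * Sobolev.vertexValue (ψ t) a) (φ : G.Sobolev p) :
    HasWeakDeriv 0 T (fun t => G.pairing (v t) φ)
      fun t => sourceTerm (f t) (ω t) (u t) φ := by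
  intro θ hθ
  obtain ⟨φ₁, hφ₁, hφv⟩ := Sobolev.exists_sobolevOne φ
  have h := heq _ _ _ (isEvolutionTest_smul hT hθ φ φ₁ hφ₁)
  -- The chosen vertex values scale with `θ t` because they are unique, which holds at vertices that
  -- belong to an edge.
  have hv : ∀ t a, Sobolev.vertexValue (θ t • φ₁) a = θ t * Sobolev.vertexValue φ a := by
    intro t a
    have hc : HasVertexValues ((θ t • φ₁ : G.SobolevOne) : G.PairSpace fun _ => 1)
        (fun a => θ t * Sobolev.vertexValue φ a) := by
      rw [Submodule.coe_smul]
      exact HasVertexValues.smul hφv (θ t)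
    exact Sobolev.vertexValue_eq (θ t • φ₁) hc (hE a)
  simp only [pairing_smul_right, pLaplaceForm_smul, hv, pairing_congr _ φ φ₁ hφ₁] at h
  simp only [smul_eq_mul, sourceTerm]
  have h1 := (hθ.integrable_mul (integrable_pairing hf φ)).1
  have h2 := (hθ.integrable_mul (integrable_pLaplaceForm hp hp_top hu φ)).1
  have h3 : ∀ a, IntegrableOn (fun t => ω t a * (θ t * Sobolev.vertexValue φ a)) (Ioo 0 T) :=
    fun a => ((hθ.integrable_mul (integrable_vertex hω a)).1.mul_const
      (Sobolev.vertexValue φ a)).congr (ae_of_all _ fun t => by ring)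
  have h4 : ∫ t in Ioo 0 T, θ t * (G.pairing (f t) φ + ∑ a, ω t a * Sobolev.vertexValue φ a
        - G.pLaplaceForm p (u t) φ)
      = (∫ t in Ioo 0 T, θ t * G.pairing (f t) φ)
        + (∑ a, ∫ t in Ioo 0 T, ω t a * (θ t * Sobolev.vertexValue φ a))
        - ∫ t in Ioo 0 T, θ t * G.pLaplaceForm p (u t) φ := by
    have h5 : Integrable (fun t => θ t * G.pairing (f t) φ
        + ∑ a, ω t a * (θ t * Sobolev.vertexValue φ a)) (volume.restrict (Ioo 0 T)) :=
      h1.add (integrable_finsetSum _ fun a _ => h3 a)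
    rw [← integral_finsetSum _ fun a _ => h3 a, ← integral_add h1
      (integrable_finsetSum _ fun a _ => h3 a), ← integral_sub h5 h2]
    refine integral_congr_ae (ae_of_all _ fun t => ?_)
    simp only [mul_sub, mul_add, Finset.mul_sum]
    congr 2
    exact Finset.sum_congr rfl fun a _ => by ring
  rw [h4]
  linarith

/-- The evolution equation, integrated in time and tested with a function of the space variable. -/
theorem pairing_sub_eq_integral (hp : ∀ e, 1 < p e) (hp_top : ∀ e, p e < ∞)
    {T : ℝ} (hT : 0 < T)
    {f : ℝ → G.L1} (hf : IntegrableOn f (Ioo 0 T)) {ω : ℝ → G.VertexL1}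
    (hω : IntegrableOn ω (Ioo 0 T)) {u : ℝ → G.Sobolev p} (hu : G.MemLpTime T u) {v : ℝ → G.L1}
    (hv : ContinuousOn v (Icc 0 T)) (φ : G.Sobolev p)
    (hw : HasWeakDeriv 0 T (fun t => G.pairing (v t) φ)
      fun t => sourceTerm (f t) (ω t) (u t) φ) {s t : ℝ} (hs : s ∈ Icc 0 T) (ht : t ∈ Icc 0 T) :
    G.pairing (v t - v s) φ = ∫ τ in s..t, sourceTerm (f τ) (ω τ) (u τ) φ := by
  have hi := integrable_sourceTerm hp hp_top hf hω hu φ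
  have hii := intervalIntegrable_of_integrableOn_Ioo hT.le hi
  have hc : ContinuousOn (fun t => G.pairing (v t) φ) (Icc 0 T) :=
    (pairingCLM φ).continuous.comp_continuousOn hv
  obtain ⟨c, hc'⟩ := hw.exists_primitive hT
    (hc.integrableOn_Icc.mono_set Ioo_subset_Icc_self) hi
  have hcont := (absolutelyContinuousOnInterval_primitive hT.le hi c).continuousOn
  rw [uIcc_of_le hT.le] at hcont
  -- Both sides are continuous on `[0, T]`, so the identity holds at every time and not only almost
  -- everywhere.
  have h : EqOn (fun t => G.pairing (v t) φ)
      (fun t => c + ∫ τ in (0 : ℝ)..t, sourceTerm (f τ) (ω τ) (u τ) φ) (Icc 0 T) :=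
    Measure.eqOn_Icc_of_ae_eq (μ := volume) hT.ne (by
      rw [← restrict_Ioo_eq_restrict_Icc]
      exact hc') hc hcont
  have h0 : ∀ r ∈ Icc 0 T, IntervalIntegrable
      (fun τ => sourceTerm (f τ) (ω τ) (u τ) φ) volume 0 r := fun r hr =>
    hii.mono_set (by rw [uIcc_of_le hr.1, uIcc_of_le hT.le]; exact Icc_subset_Icc_right hr.2)
  have h1 : G.pairing (v t) φ = _ := h ht
  have h2 : G.pairing (v s) φ = _ := h hs
  rw [← pairingCLM_apply, map_sub, pairingCLM_apply, pairingCLM_apply, h1, h2,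
    ← intervalIntegral.integral_interval_sub_left (h0 t ht) (h0 s hs)]
  ring

/-! ### Convex functionals that approximate the distance in `L¹(G)` -/

/-- The sum over the edges of the integrals of the entropies. -/
noncomputable def entropyFunctional (S : ℝ → ℝ) (β γ : E → ℝ → ℝ) (w : G.Sobolev p) (v : G.L1) :
    ℝ :=
  ∑ e, ∫ x in Ioo 0 (G.length e), entropy S (β e) (γ e) (Sobolev.fn w e x) (v e x)

section

variable {S : ℝ → ℝ} {β γ : E → ℝ → ℝ} {w : G.Sobolev p} {z : G.L1}

/-- The Lipschitz constant `1` does not depend on `S`; it yields continuity and the domination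
needed in the limit `n → ∞`. -/
theorem abs_entropyFunctional_sub_le (hS : Continuous S) (hβ : ∀ e, Continuous (β e))
    (hγ : ∀ e, Continuous (γ e)) (hS1 : ∀ y, |S y| ≤ 1)
    (hz : ∀ e, z e =ᵐ[G.edgeMeasure e] fun x => γ e (Sobolev.fn w e x)) (v v' : G.L1) :
    |entropyFunctional S β γ w v' - entropyFunctional S β γ w v| ≤ ‖v' - v‖ := by
  rw [entropyFunctional, entropyFunctional, ← Finset.sum_sub_distrib, PiLp.norm_eq_of_L1]
  refine (Finset.abs_sum_le_sum_abs _ _).trans (Finset.sum_le_sum fun e _ => ?_)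
  refine (abs_integral_entropy_sub_le hS (hβ e) (hγ e) hS1 (Sobolev.integrable_fn w e).1
    ((L1.integrable_coeFn (z e)).congr (hz e)) (L1.integrable_coeFn (v e))
    (L1.integrable_coeFn (v' e))).trans_eq ?_
  rw [L1.norm_eq_integral_norm]
  refine integral_congr_ae ?_
  filter_upwards [Lp.coeFn_sub (v' e) (v e)] with x hx
  change _ = ‖(v' e - v e : Lp ℝ 1 (G.edgeMeasure e)) x‖
  rw [hx]
  rfl

theorem entropyFunctional_self
    (hz : ∀ e, z e =ᵐ[G.edgeMeasure e] fun x => γ e (Sobolev.fn w e x)) :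
    entropyFunctional S β γ w z = 0 := by
  refine Finset.sum_eq_zero fun e _ => integral_eq_zero_of_ae ?_
  filter_upwards [hz e] with x hx
  rw [hx]
  exact entropy_self _

theorem abs_entropyFunctional_le (hS : Continuous S) (hβ : ∀ e, Continuous (β e))
    (hγ : ∀ e, Continuous (γ e)) (hS1 : ∀ y, |S y| ≤ 1)
    (hz : ∀ e, z e =ᵐ[G.edgeMeasure e] fun x => γ e (Sobolev.fn w e x)) (v : G.L1) :
    |entropyFunctional S β γ w v| ≤ ‖v - z‖ := by
  simpa [entropyFunctional_self hz] using abs_entropyFunctional_sub_le hS hβ hγ hS1 hz z v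

theorem continuous_entropyFunctional (hS : Continuous S) (hβ : ∀ e, Continuous (β e))
    (hγ : ∀ e, Continuous (γ e)) (hS1 : ∀ y, |S y| ≤ 1)
    (hz : ∀ e, z e =ᵐ[G.edgeMeasure e] fun x => γ e (Sobolev.fn w e x)) :
    Continuous (entropyFunctional (G := G) S β γ w) :=
  (LipschitzWith.of_dist_le_mul (K := 1) fun v v' => by
    rw [NNReal.coe_one, one_mul, Real.dist_eq, dist_eq_norm]
    exact abs_entropyFunctional_sub_le hS hβ hγ hS1 hz v' v).continuous

/-- The subgradient of the entropy functional. -/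
theorem pairing_sub_le_entropyFunctional_sub (hS : Continuous S) (hβ : ∀ e, Continuous (β e))
    (hγ : ∀ e, Continuous (γ e)) (hS1 : ∀ y, |S y| ≤ 1) (hSm : Monotone S)
    (hβm : ∀ e, Monotone (β e)) (hβγ : ∀ e y, β e (γ e y) = y)
    (hz : ∀ e, z e =ᵐ[G.edgeMeasure e] fun x => γ e (Sobolev.fn w e x))
    {u φ : G.Sobolev p} {v : G.L1}
    (hv : ∀ e, v e =ᵐ[G.edgeMeasure e] fun x => γ e (Sobolev.fn u e x))
    (hφ : ∀ e, Sobolev.fn φ e =ᵐ[G.edgeMeasure e]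
      fun x => S (Sobolev.fn u e x - Sobolev.fn w e x)) (v' : G.L1) :
    G.pairing (v' - v) φ ≤ entropyFunctional S β γ w v' - entropyFunctional S β γ w v := by
  rw [entropyFunctional, entropyFunctional, ← Finset.sum_sub_distrib]
  refine Finset.sum_le_sum fun e _ => ?_
  refine le_of_eq_of_le ?_ (integral_mul_sub_le_integral_entropy_sub hS (hβ e) (hγ e) hS1 hSm
    (hβm e) (Sobolev.integrable_fn w e).1 ((L1.integrable_coeFn (z e)).congr (hz e))
    (L1.integrable_coeFn (v e)) (L1.integrable_coeFn (v' e)))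
  refine integral_congr_ae ?_
  filter_upwards [Lp.coeFn_sub (v' e) (v e), hv e, hφ e] with x h1 h2 h3
  change (v' e - v e : Lp ℝ 1 (G.edgeMeasure e)) x * _ = _
  -- The relation `β(v) = β(γ(u)) = u` identifies the subgradient `S(β(v) - w)` with the Sobolev
  -- function `φ`.
  rw [h1, h3, Pi.sub_apply, h2, hβγ, mul_comm]

theorem tendsto_entropyFunctional (hβ : ∀ e, Continuous (β e)) (hγ : ∀ e, Continuous (γ e))
    (hβm : ∀ e, StrictMono (β e)) (hβγ : ∀ e y, β e (γ e y) = y)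
    (hz : ∀ e, z e =ᵐ[G.edgeMeasure e] fun x => γ e (Sobolev.fn w e x)) (v : G.L1) :
    Tendsto (fun n => entropyFunctional (smoothSign n) β γ w v) atTop (𝓝 ‖v - z‖) := by
  rw [PiLp.norm_eq_of_L1]
  refine tendsto_finsetSum _ fun e _ => ?_
  convert tendsto_integral_entropy_smoothSign (hβ e) (hγ e) (hβm e) (hβγ e)
    (Sobolev.integrable_fn w e).1 ((L1.integrable_coeFn (z e)).congr (hz e))
    (L1.integrable_coeFn (v e)) using 2
  rw [L1.norm_eq_integral_norm]
  refine integral_congr_ae ?_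
  filter_upwards [Lp.coeFn_sub (v e) (z e), hz e] with x h1 h2
  change ‖(v e - z e : Lp ℝ 1 (G.edgeMeasure e)) x‖ = _
  rw [h1, Pi.sub_apply, h2]
  rfl

end

end CompactMetricGraph

/-! ### Brackets -/

section Bracket

variable {X : Type*} [NormedAddCommGroup X] [NormedSpace ℝ X]

theorem abs_norm_quotient_le (x y : X) {r : ℝ} (hr : 0 < r) :
    |(‖x + r • y‖ - ‖x‖) / r| ≤ ‖y‖ := by
  rw [abs_div, abs_of_pos hr, div_le_iff₀ hr]
  refine (abs_norm_sub_norm_le _ _).trans_eq ?_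
  rw [add_sub_cancel_left, norm_smul, Real.norm_of_nonneg hr.le, mul_comm]

theorem abs_normBracket_le (x y : X) : |normBracket x y| ≤ ‖y‖ :=
  le_of_tendsto (tendsto_normBracket x y).abs (by
    filter_upwards [self_mem_nhdsWithin] with r hr using abs_norm_quotient_le x y hr)

/-- Only the graph without edges needs this, where `W(t) - x = 0`. -/
theorem normBracket_zero_nonneg (y : X) : 0 ≤ normBracket 0 y :=
  ge_of_tendsto (tendsto_normBracket 0 y) (by
    filter_upwards [self_mem_nhdsWithin] with r hr
    have : (0 : ℝ) < r := hr
    rw [norm_zero, sub_zero]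
    positivity)

/-- The bracket is a pointwise limit of measurable difference quotients, all bounded by the norm of
the second argument. -/
theorem integrable_normBracket {α : Type*} [MeasurableSpace α] {μ : Measure α} {x y : α → X}
    (hx : AEStronglyMeasurable x μ) (hy : Integrable y μ) :
    Integrable (fun t => normBracket (x t) (y t)) μ := by
  refine hy.norm.mono ?_ (ae_of_all _ fun t => ?_)
  · refine aestronglyMeasurable_of_tendsto_ae (𝓝[>] (0 : ℝ))
      (f := fun r t => (‖x t + r • y t‖ - ‖x t‖) / r) (fun r => ?_)
      (ae_of_all _ fun t => tendsto_normBracket _ _)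
    simp only [div_eq_mul_inv]
    exact ((hx.add (hy.1.const_smul r)).norm.sub hx.norm).mul_const _
  · rw [norm_norm]
    exact abs_normBracket_le _ _

end Bracket

/-! ### Difference quotients in time -/

/-- As a function of `h`, `∫ ξ(s) g(s - h) ds` is the convolution of `ξ` with `g(-·)`. It is
differentiable with the derivative falling on `ξ`, although `g` is merely continuous. -/
theorem tendsto_integral_sub_translate_div {T : ℝ} {ξ : ℝ → ℝ} (hξ : IsScalarTest 0 T ξ)
    {g : ℝ → ℝ} (hg : Continuous g) :
    Tendsto (fun h => (∫ s, ξ s * (g s - g (s - h))) / h) (𝓝[>] 0)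
      (𝓝 (-∫ s, g s * deriv ξ s)) := by
  have hgn : Continuous fun y => g (-y) := hg.comp continuous_neg
  have hd := hξ.compact.hasDerivAt_convolution_left (ContinuousLinearMap.mul ℝ ℝ)
    (μ := volume) (hξ.smooth.of_le (by exact_mod_cast le_top)) hgn.locallyIntegrable 0
  have h1 := ((hasDerivAt_iff_tendsto_slope.1 hd).mono_left
    (nhdsWithin_mono 0 fun x (hx : 0 < x) => hx.ne')).neg
  have h2 : ∀ h : ℝ, MeasureTheory.convolution ξ (fun y => g (-y)) (ContinuousLinearMap.mul ℝ ℝ)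
      volume h = ∫ s, ξ s * g (s - h) := fun h => by
    simp only [MeasureTheory.convolution, ContinuousLinearMap.mul_apply', neg_sub]
  have h3 : MeasureTheory.convolution (deriv ξ) (fun y => g (-y)) (ContinuousLinearMap.mul ℝ ℝ)
      volume 0 = ∫ s, g s * deriv ξ s := by
    simp only [MeasureTheory.convolution, ContinuousLinearMap.mul_apply', neg_sub, sub_zero,
      mul_comm]
  have hi : ∀ h : ℝ, Integrable fun s => ξ s * g (s - h) := fun h =>
    (hξ.smooth.continuous.mul (hg.comp (continuous_id.sub
      continuous_const))).integrable_of_hasCompactSupport hξ.compact.mul_right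
  rw [h3] at h1
  refine h1.congr fun h => ?_
  have h0 := hi 0
  simp only [sub_zero] at h0
  rw [slope_def_field, h2, h2]
  simp only [mul_sub, sub_zero]
  rw [integral_sub h0 (hi h), ← neg_div, neg_sub]

section TranslationSum

variable {F : Type*} [NormedAddCommGroup F]

theorem aemeasurable_translate_right {f : ℝ → F} (hf : AEStronglyMeasurable f volume) (M : ℝ → ℝ)
    (s h : ℝ) : AEMeasurable (fun σ => ‖M s‖ₑ * ‖f (s - σ) - f s‖ₑ) (volume.restrict (Ioo 0 h)) :=
  ((((hf.comp_measurePreserving (Measure.measurePreserving_sub_left volume s)).sub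
    aestronglyMeasurable_const).enorm).const_mul _).restrict

/-- The single pair of exponents is for the data (`1` and `∞`), the family for the fluxes on the
edges. -/
theorem tendsto_lintegral_translate_sum_div [NormedSpace ℝ F] {ι : Type*} [Fintype ι]
    {H : ι → Type*} [∀ i, NormedAddCommGroup (H i)] [∀ i, NormedSpace ℝ (H i)]
    {q q' : ℝ≥0∞} (hqq' : q'.HolderConjugate q) (hq : q ≠ ∞) {f : ℝ → F} (hf : MemLp f q volume)
    {M : ℝ → ℝ} (hM : MemLp M q' volume) {r r' : ι → ℝ≥0∞} (hrr' : ∀ i, (r' i).HolderConjugate (r i))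
    (hr : ∀ i, r i ≠ ∞) {g : ∀ i, ℝ → H i} (hg : ∀ i, MemLp (g i) (r i) volume) {N : ι → ℝ → ℝ}
    (hN : ∀ i, MemLp (N i) (r' i) volume) :
    Tendsto (fun h : ℝ => (∫⁻ s, ∫⁻ σ in Ioo 0 h, (‖M s‖ₑ * ‖f (s - σ) - f s‖ₑ
      + ∑ i, ‖N i s‖ₑ * ‖g i (s - σ) - g i s‖ₑ)) / ENNReal.ofReal h) (𝓝[>] 0) (𝓝 0) := by
  have h1 := (tendsto_lintegral_translate_sub_div hqq' hq hf hM).add (tendsto_finsetSum Finset.univ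
    fun i _ => tendsto_lintegral_translate_sub_div (hrr' i) (hr i) (hg i) (hN i))
  rw [Finset.sum_const_zero, add_zero] at h1
  refine h1.congr fun h => ?_
  simp only [div_eq_mul_inv]
  rw [← Finset.sum_mul, ← add_mul]
  congr 1
  have hA : AEMeasurable (fun s => ∫⁻ σ in Ioo 0 h, ‖M s‖ₑ * ‖f (s - σ) - f s‖ₑ) volume :=
    (aemeasurable_translate hf.1 hM.1 h).lintegral_prod_right'
  have hB : ∀ i ∈ (Finset.univ : Finset ι), AEMeasurable
      (fun s => ∫⁻ σ in Ioo 0 h, ‖N i s‖ₑ * ‖g i (s - σ) - g i s‖ₑ) volume := fun i _ =>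
    (aemeasurable_translate (hg i).1 (hN i).1 h).lintegral_prod_right'
  rw [← lintegral_finsetSum' _ hB, ← lintegral_add_left' hA]
  refine lintegral_congr fun s => ?_
  rw [lintegral_add_left' (aemeasurable_translate_right hf.1 M s h), lintegral_finsetSum' _
    fun i _ => aemeasurable_translate_right (hg i).1 (N i) s h]

end TranslationSum

namespace CompactMetricGraph

variable {V E : Type*} [Fintype V] [Fintype E] {G : CompactMetricGraph V E}
  {p : E → ℝ≥0∞} [∀ e, Fact (1 ≤ p e)]

/-! ### The entropy inequality -/

theorem abs_sum_mul_vertexValue_le (ω : G.VertexL1) (φ : G.Sobolev p)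
    (hφ : ∀ a, |Sobolev.vertexValue φ a| ≤ 1) :
    |∑ a, ω a * Sobolev.vertexValue φ a| ≤ ‖ω‖ := by
  rw [PiLp.norm_eq_of_L1]
  refine (Finset.abs_sum_le_sum_abs _ _).trans (Finset.sum_le_sum fun a _ => ?_)
  rw [abs_mul]
  exact mul_le_of_le_one_right (abs_nonneg _) (hφ a)

/-- The data only see the bounds on `φ` itself, which are `1` on edges and at vertices; the
derivative of `φ` enters only against the flux, by Hölder. -/
theorem abs_sourceTerm_sub_le (hp : ∀ e, 1 < p e) (hp_top : ∀ e, p e < ∞) (f f' : G.L1)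
    (ω ω' : G.VertexL1) (u u' φ : G.Sobolev p)
    (hφ : ∀ e, ∀ᵐ x ∂(G.edgeMeasure e), |Sobolev.fn φ e x| ≤ 1)
    (hφ' : ∀ a, |Sobolev.vertexValue φ a| ≤ 1) :
    |sourceTerm f ω u φ - sourceTerm f' ω' u' φ|
      ≤ ‖(WithLp.toLp 1 (f, ω) : G.StateSpace) - WithLp.toLp 1 (f', ω')‖
        + ∑ e, ‖((φ : G.PairSpace p) e).snd‖ * ‖flux hp hp_top u e - flux hp hp_top u' e‖ := by
  have h1 : sourceTerm f ω u φ - sourceTerm f' ω' u' φ = G.pairing (f - f') φ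
      + ∑ a, (ω - ω') a * Sobolev.vertexValue φ a
      + -∑ e, derCLM φ e (flux hp hp_top u e - flux hp hp_top u' e) := by
    have h2 : ∑ a, (ω - ω') a * Sobolev.vertexValue φ a = ∑ a, ω a * Sobolev.vertexValue φ a
        - ∑ a, ω' a * Sobolev.vertexValue φ a := by
      rw [← Finset.sum_sub_distrib]
      exact Finset.sum_congr rfl fun a _ => by rw [PiLp.sub_apply, sub_mul]
    rw [h2, ← pairingCLM_apply, map_sub]
    simp only [map_sub, Finset.sum_sub_distrib, sourceTerm, pLaplaceForm_eq_sum hp hp_top,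
      pairingCLM_apply]
    ring
  rw [h1, WithLp.prod_norm_eq_of_L1]
  refine (abs_add_three _ _ _).trans (add_le_add_three ?_ ?_ ?_)
  · exact (abs_pairing_le _ φ hφ).trans_eq (one_mul _)
  · exact abs_sum_mul_vertexValue_le _ φ hφ'
  · rw [abs_neg]
    exact (Finset.abs_sum_le_sum_abs _ _).trans (Finset.sum_le_sum fun e _ => abs_derCLM_le _ _ _)

variable {β γ : E → ℝ → ℝ} {w : G.Sobolev p} {z : G.L1}

/-- The test function `S(u - w)`, where `S` approximates the sign function. -/
theorem exists_smoothSign_sub (hE : ∀ a, ∃ e, G.init e = a ∨ G.term e = a) (n : ℕ)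
    (u w : G.Sobolev p) : ∃ φ : G.Sobolev p,
      (∀ e, Sobolev.fn φ e =ᵐ[G.edgeMeasure e]
        fun x => smoothSign n (Sobolev.fn u e x - Sobolev.fn w e x)) ∧
      (∃ k : E → ℝ → ℝ, (∀ e x, 0 ≤ k e x) ∧ ∀ e, Sobolev.der φ e =ᵐ[G.edgeMeasure e]
        fun x => k e x * (Sobolev.der u e x - Sobolev.der w e x)) ∧
      (∀ e, ‖((φ : G.PairSpace p) e).snd‖
        ≤ n * ‖((u : G.PairSpace p) e).snd - ((w : G.PairSpace p) e).snd‖) ∧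
      (∀ e, ∀ᵐ x ∂(G.edgeMeasure e), |Sobolev.fn φ e x| ≤ 1) ∧
      ∀ a, |Sobolev.vertexValue φ a| ≤ 1 := by
  obtain ⟨φ, h1, h2, h3⟩ := Sobolev.exists_comp (u - w) (lipschitzWith_smoothSign n)
    (hasDerivAt_smoothSign n) (continuous_smoothSignDeriv n) fun y => by
      rw [abs_of_nonneg (smoothSignDeriv_nonneg n y)]; simpa using smoothSignDeriv_le n y
  refine ⟨φ, fun e => ?_, ⟨fun e x => smoothSignDeriv n (Sobolev.fn (u - w) e x),
    fun e x => smoothSignDeriv_nonneg n _, fun e => ?_⟩, fun e => ?_, fun e => ?_, fun a => ?_⟩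
  · filter_upwards [h1 e, Sobolev.fn_sub u w e] with x hx hx'
    rw [hx, hx']
  · filter_upwards [h2 e, Sobolev.der_sub u w e] with x hx hx'
    rw [hx, hx']
  · refine Lp.norm_le_mul_norm_of_ae_le_mul ?_
    filter_upwards [h2 e] with x hx
    change ‖Sobolev.der φ e x‖ ≤ n * ‖Sobolev.der (u - w) e x‖
    rw [hx, norm_mul, Real.norm_of_nonneg (smoothSignDeriv_nonneg n _)]
    exact mul_le_mul_of_nonneg_right (smoothSignDeriv_le n _) (norm_nonneg _)
  · filter_upwards [h1 e] with x hx
    rw [hx]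
    exact abs_smoothSign_le_one n _
  · rw [Sobolev.vertexValue_eq φ h3 (hE a)]
    exact abs_smoothSign_le_one n _

/-- An upper bound for the time derivative of the entropy. -/
noncomputable def entropyRate (n : ℕ) (β γ : E → ℝ → ℝ) (w : G.Sobolev p) (r : ℝ)
    (v : G.L1) (y : G.StateSpace) : ℝ :=
  (entropyFunctional (smoothSign n) β γ w (v + r • y.fst)
    - entropyFunctional (smoothSign n) β γ w v) / r + ‖y.snd‖

/-- The core of the proof, at a fixed time `s`. The test function `S_n(u(s) - w)` appears only
inside the proof; the bound involves just norms, so no measurability of the test function in `s` is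
ever needed. Working in `ℝ≥0∞` allows the error to be infinite for some `s`. -/
theorem ofReal_entropyFunctional_sub_le (hp : ∀ e, 1 < p e) (hp_top : ∀ e, p e < ∞)
    (hE : ∀ a, ∃ e, G.init e = a ∨ G.term e = a)
    (hβ : ∀ e, Continuous (β e)) (hγ : ∀ e, Continuous (γ e)) (hβm : ∀ e, StrictMono (β e))
    (hβγ : ∀ e y, β e (γ e y) = y)
    (hz : ∀ e, z e =ᵐ[G.edgeMeasure e] fun x => γ e (Sobolev.fn w e x))
    {v' : G.L1} {ω' : G.VertexL1}
    (hw : ∀ φ : G.Sobolev p, G.pLaplaceForm p w φ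
      = G.pairing v' φ + ∑ a, ω' a * Sobolev.vertexValue φ a)
    {f v : ℝ → G.L1} {ω : ℝ → G.VertexL1} {u : ℝ → G.Sobolev p} {s h r : ℝ} (hh : 0 < h)
    (hr : 0 < r)
    (hi : ∀ φ : G.Sobolev p, IntervalIntegrable
      (fun τ => sourceTerm (f τ) (ω τ) (u τ) φ) volume (s - h) s)
    (hv : ∀ φ : G.Sobolev p, G.pairing (v s - v (s - h)) φ
      = ∫ τ in (s - h)..s, sourceTerm (f τ) (ω τ) (u τ) φ)
    (hvs : ∀ e, v s e =ᵐ[G.edgeMeasure e] fun x => γ e (Sobolev.fn (u s) e x)) (n : ℕ) :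
    ENNReal.ofReal (entropyFunctional (smoothSign n) β γ w (v s)
        - entropyFunctional (smoothSign n) β γ w (v (s - h))
        - h * entropyRate n β γ w r (v s)
          ((WithLp.toLp 1 (f s, ω s) : G.StateSpace) - WithLp.toLp 1 (v', ω')))
      ≤ ∫⁻ σ in Ioo 0 h, (‖(WithLp.toLp 1 (f (s - σ), ω (s - σ)) : G.StateSpace)
          - WithLp.toLp 1 (f s, ω s)‖ₑ
        + ∑ e, ‖n * ‖((u s : G.PairSpace p) e).snd - ((w : G.PairSpace p) e).snd‖‖ₑ
          * ‖flux hp hp_top (u (s - σ)) e - flux hp hp_top (u s) e‖ₑ) := by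
  obtain ⟨φ, h1, ⟨k, hk, h2⟩, h3, h4, h5⟩ := exists_smoothSign_sub hE n (u s) w
  -- The same subgradient inequality serves twice: for `v (s - h)` and for `v s + r • (f s - v')`.
  have hsub := fun v'' => pairing_sub_le_entropyFunctional_sub (continuous_smoothSign n) hβ hγ
    (abs_smoothSign_le_one n) (monotone_smoothSign n) (fun e => (hβm e).monotone) hβγ hz hvs h1 v''
  have hinc : entropyFunctional (smoothSign n) β γ w (v s)
      - entropyFunctional (smoothSign n) β γ w (v (s - h))
      ≤ ∫ τ in (s - h)..s, sourceTerm (f τ) (ω τ) (u τ) φ := by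
    have ha := hsub (v (s - h))
    rw [← hv φ, ← neg_sub (v (s - h)), ← pairingCLM_apply, map_neg, pairingCLM_apply]
    linarith
  -- Monotonicity replaces the flux of `u s` by that of `w`, and the stationary equation turns the
  -- latter into the data `v'`, `ω'`.
  have hrate : sourceTerm (f s) (ω s) (u s) φ ≤ entropyRate n β γ w r (v s)
      ((WithLp.toLp 1 (f s, ω s) : G.StateSpace) - WithLp.toLp 1 (v', ω')) := by
    have ha := pLaplaceForm_le hp hp_top (u s) w φ k hk h2
    rw [hw] at ha
    have hb := hsub (v s + r • (f s - v'))
    rw [add_sub_cancel_left, pairing_smul, mul_comm] at hb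
    have hc := (le_div_iff₀ hr).2 hb
    have hd := le_of_abs_le (abs_sum_mul_vertexValue_le (ω s - ω') φ h5)
    have he : ∑ a, (ω s - ω') a * Sobolev.vertexValue φ a
        = ∑ a, ω s a * Sobolev.vertexValue φ a - ∑ a, ω' a * Sobolev.vertexValue φ a := by
      rw [← Finset.sum_sub_distrib]
      exact Finset.sum_congr rfl fun a _ => by rw [PiLp.sub_apply, sub_mul]
    rw [← pairingCLM_apply, map_sub, pairingCLM_apply, pairingCLM_apply] at hc
    rw [he] at hd
    rw [entropyRate]
    change sourceTerm (f s) (ω s) (u s) φ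
      ≤ (entropyFunctional (smoothSign n) β γ w (v s + r • (f s - v'))
        - entropyFunctional (smoothSign n) β γ w (v s)) / r + ‖ω s - ω'‖
    rw [sourceTerm]
    linarith
  -- The error of freezing the time at `s`, after the substitution `τ = s - σ`.
  have hint : (∫ τ in (s - h)..s, sourceTerm (f τ) (ω τ) (u τ) φ)
        - h * sourceTerm (f s) (ω s) (u s) φ
      = ∫ σ in Ioo 0 h, (sourceTerm (f (s - σ)) (ω (s - σ)) (u (s - σ)) φ
        - sourceTerm (f s) (ω s) (u s) φ) := by
    have hc : h * sourceTerm (f s) (ω s) (u s) φ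
        = ∫ _ in (s - h)..s, sourceTerm (f s) (ω s) (u s) φ := by
      rw [intervalIntegral.integral_const, smul_eq_mul, sub_sub_cancel]
    rw [hc, ← intervalIntegral.integral_sub (hi φ) intervalIntegrable_const,
      ← integral_Ioc_eq_integral_Ioo, ← intervalIntegral.integral_of_le hh.le,
      intervalIntegral.integral_comp_sub_left (fun τ => sourceTerm (f τ) (ω τ) (u τ) φ
        - sourceTerm (f s) (ω s) (u s) φ) s, sub_zero]
  refine (ENNReal.ofReal_le_ofReal (q := ∫ σ in Ioo 0 h,
    (sourceTerm (f (s - σ)) (ω (s - σ)) (u (s - σ)) φ - sourceTerm (f s) (ω s) (u s) φ)) ?_).trans ?_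
  · rw [← hint]
    have := mul_le_mul_of_nonneg_left hrate hh.le
    linarith
  refine (Real.ofReal_le_enorm _).trans ((enorm_integral_le_lintegral_enorm _).trans ?_)
  refine lintegral_mono fun σ => ?_
  have hb := abs_sourceTerm_sub_le hp hp_top (f (s - σ)) (f s) (ω (s - σ)) (ω s) (u (s - σ)) (u s)
    φ h4 h5
  have hb' : |sourceTerm (f (s - σ)) (ω (s - σ)) (u (s - σ)) φ - sourceTerm (f s) (ω s) (u s) φ|
      ≤ ‖(WithLp.toLp 1 (f (s - σ), ω (s - σ)) : G.StateSpace) - WithLp.toLp 1 (f s, ω s)‖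
        + ∑ e, (n * ‖((u s : G.PairSpace p) e).snd - ((w : G.PairSpace p) e).snd‖)
          * ‖flux hp hp_top (u (s - σ)) e - flux hp hp_top (u s) e‖ := by
    refine hb.trans ?_
    gcongr with e
    exact h3 e
  rw [← Real.norm_eq_abs] at hb'
  have hfin := ENNReal.ofReal_le_ofReal hb'
  rw [ofReal_norm, ENNReal.ofReal_add (norm_nonneg _)
    (Finset.sum_nonneg fun e _ => by positivity), ofReal_norm,
    ENNReal.ofReal_sum_of_nonneg (fun e _ => by positivity)] at hfin
  refine hfin.trans_eq ?_
  congr 1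
  refine Finset.sum_congr rfl fun e _ => ?_
  rw [ENNReal.ofReal_mul (by positivity), ofReal_norm, ← Real.enorm_of_nonneg (by positivity)]

end CompactMetricGraph

/-! ### The entropy inequality in the sense of distributions -/

theorem IsScalarTest.deriv_eq_zero {a b : ℝ} {φ : ℝ → ℝ} (h : IsScalarTest a b φ) {x : ℝ}
    (hx : x ∉ Ioo a b) : deriv φ x = 0 :=
  image_eq_zero_of_notMem_tsupport fun hx' => hx (h.support (tsupport_deriv_subset hx'))

theorem integral_le_toReal_lintegral_ofReal {α : Type*} [MeasurableSpace α] {μ : Measure α}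
    {f : α → ℝ} (hf : Integrable f μ) : ∫ x, f x ∂μ ≤ (∫⁻ x, ENNReal.ofReal (f x) ∂μ).toReal := by
  rw [integral_eq_lintegral_pos_part_sub_lintegral_neg_part hf]
  exact sub_le_self _ ENNReal.toReal_nonneg

namespace CompactMetricGraph

variable {V E : Type*} [Fintype V] [Fintype E] {G : CompactMetricGraph V E}
  {p : E → ℝ≥0∞} [∀ e, Fact (1 ≤ p e)] {β γ : E → ℝ → ℝ} {w : G.Sobolev p} {z : G.L1}

theorem integrable_stateSpace {T : ℝ} {f : ℝ → G.L1} (hf : IntegrableOn f (Ioo 0 T))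
    {ω : ℝ → G.VertexL1} (hω : IntegrableOn ω (Ioo 0 T)) :
    IntegrableOn (fun t => (WithLp.toLp 1 (f t, ω t) : G.StateSpace)) (Ioo 0 T) :=
  ((WithLp.prodContinuousLinearEquiv 1 ℝ G.L1 G.VertexL1).symm :
    (G.L1 × G.VertexL1) →L[ℝ] G.StateSpace).integrable_comp (hf.prodMk hω)

/-- The bound is uniform in `n` and `r`, so it dominates in the limit `n → ∞`. -/
theorem abs_entropyRate_le (hβ : ∀ e, Continuous (β e)) (hγ : ∀ e, Continuous (γ e))
    (hz : ∀ e, z e =ᵐ[G.edgeMeasure e] fun x => γ e (Sobolev.fn w e x)) (n : ℕ) {r : ℝ}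
    (hr : 0 < r) (v : G.L1) (y : G.StateSpace) : |entropyRate n β γ w r v y| ≤ ‖y‖ := by
  rw [entropyRate, WithLp.prod_norm_eq_of_L1]
  refine (abs_add_le _ _).trans (add_le_add ?_ (abs_norm _).le)
  rw [abs_div, abs_of_pos hr, div_le_iff₀ hr]
  refine (abs_entropyFunctional_sub_le (continuous_smoothSign n) hβ hγ (abs_smoothSign_le_one n)
    hz _ _).trans_eq ?_
  rw [add_sub_cancel_left, norm_smul, Real.norm_of_nonneg hr.le, mul_comm]

theorem aestronglyMeasurable_entropyRate {α : Type*} [MeasurableSpace α] {μ : Measure α}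
    (hβ : ∀ e, Continuous (β e)) (hγ : ∀ e, Continuous (γ e))
    (hz : ∀ e, z e =ᵐ[G.edgeMeasure e] fun x => γ e (Sobolev.fn w e x)) (n : ℕ) (r : ℝ)
    {v : α → G.L1} (hv : AEStronglyMeasurable v μ) {y : α → G.StateSpace}
    (hy : AEStronglyMeasurable y μ) :
    AEStronglyMeasurable (fun t => entropyRate n β γ w r (v t) (y t)) μ := by
  have hJ := continuous_entropyFunctional (continuous_smoothSign n) hβ hγ
    (abs_smoothSign_le_one n) hz
  simp only [entropyRate, div_eq_mul_inv]
  exact (((hJ.comp_aestronglyMeasurable (hv.add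
    (((WithLp.continuous_fst _ _ _).comp_aestronglyMeasurable hy).const_smul r))).sub
    (hJ.comp_aestronglyMeasurable hv)).mul_const _).add
    ((WithLp.continuous_snd _ _ _).comp_aestronglyMeasurable hy).norm

/-- The entropy inequality in the sense of distributions. -/
theorem neg_integral_entropyFunctional_le (hp : ∀ e, 1 < p e) (hp_top : ∀ e, p e < ∞)
    (hE : ∀ a, ∃ e, G.init e = a ∨ G.term e = a)
    (hβ : ∀ e, Continuous (β e)) (hγ : ∀ e, Continuous (γ e)) (hβm : ∀ e, StrictMono (β e))
    (hβγ : ∀ e y, β e (γ e y) = y)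
    (hz : ∀ e, z e =ᵐ[G.edgeMeasure e] fun x => γ e (Sobolev.fn w e x)) {y : G.StateSpace}
    (hw : ∀ φ : G.Sobolev p, G.pLaplaceForm p w φ
      = G.pairing y.fst φ + ∑ a, y.snd a * Sobolev.vertexValue φ a)
    {T : ℝ} (hT : 0 < T) {f v : ℝ → G.L1} {ω : ℝ → G.VertexL1} {u : ℝ → G.Sobolev p}
    (hf : IntegrableOn f (Ioo 0 T)) (hω : IntegrableOn ω (Ioo 0 T)) (hu : G.MemLpTime T u)
    (hv : ContinuousOn v (Icc 0 T))
    (hvu : ∀ᵐ t ∂(volume.restrict (Ioo 0 T)), ∀ e,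
      v t e =ᵐ[G.edgeMeasure e] fun x => γ e (Sobolev.fn (u t) e x))
    (heq : ∀ φ : G.Sobolev p, ∀ s ∈ Icc 0 T, ∀ t ∈ Icc 0 T, G.pairing (v t - v s) φ
      = ∫ τ in s..t, sourceTerm (f τ) (ω τ) (u τ) φ) (n : ℕ) {r : ℝ} (hr : 0 < r)
    {ξ : ℝ → ℝ} (hξ : IsScalarTest 0 T ξ) (hξ0 : ∀ t, 0 ≤ ξ t) :
    -∫ t in Ioo 0 T, entropyFunctional (smoothSign n) β γ w (v t) * deriv ξ t
      ≤ ∫ t in Ioo 0 T, entropyRate n β γ w r (v t)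
          ((WithLp.toLp 1 (f t, ω t) : G.StateSpace) - y) * ξ t := by
  set J := entropyFunctional (smoothSign n) β γ w with hJdef
  set X : ℝ → G.StateSpace := fun t => WithLp.toLp 1 (f t, ω t) with hX
  have hJ : Continuous J := continuous_entropyFunctional (continuous_smoothSign n) hβ hγ
    (abs_smoothSign_le_one n) hz
  obtain ⟨C, hC⟩ := hξ.compact.exists_bound_of_continuous hξ.smooth.continuous
  have hC0 : 0 ≤ C := (norm_nonneg _).trans (hC 0)
  obtain ⟨c, d, hc, hcd, hd, hout⟩ := hξ.exists_Icc hT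
  -- a continuous extension of `v`
  set g : ℝ → ℝ := fun s => J (v (max 0 (min s T))) with hgdef
  have hg : Continuous g := hJ.comp (hv.comp_continuous (by fun_prop) fun s =>
    ⟨le_max_left _ _, max_le hT.le (min_le_right _ _)⟩)
  have hgv : ∀ s ∈ Ioo 0 T, g s = J (v s) := fun s hs => by
    simp only [hgdef]
    rw [min_eq_left hs.2.le, max_eq_right hs.1.le]
  -- the error terms
  set ℓ : E → ℝ → ℝ := fun e s =>
    n * ‖((u s : G.PairSpace p) e).snd - ((w : G.PairSpace p) e).snd‖ with hℓ
  have hXi : IntegrableOn X (Ioo 0 T) := integrable_stateSpace hf hω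
  -- All functions of time are extended by zero, because the translation estimates are on the whole
  -- line.
  have hMemX : MemLp ((Ioo 0 T).indicator X) 1 volume :=
    memLp_one_iff_integrable.2 (hXi.integrable_indicator measurableSet_Ioo)
  have hMemM : MemLp ((Ioo 0 T).indicator fun _ => (1 : ℝ)) ∞ volume :=
    (memLp_indicator_iff_restrict measurableSet_Ioo).2 (memLp_const 1)
  have hMemF : ∀ e, MemLp ((Ioo 0 T).indicator fun t => flux hp hp_top (u t) e)
      (ENNReal.conjExponent (p e)) volume := fun e =>
    (memLp_indicator_iff_restrict measurableSet_Ioo).2 (memLp_flux_time hp hp_top hu e)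
  have hMemℓ : ∀ e, MemLp ((Ioo 0 T).indicator (ℓ e)) (p e) volume := fun e =>
    (memLp_indicator_iff_restrict measurableSet_Ioo).2
      (((memLp_der_time hu e).sub (memLp_const _)).norm.const_mul _)
  have hconj : ∀ e, ENNReal.conjExponent (p e) ≠ ∞ := fun e h =>
    (hp e).ne' ((ENNReal.HolderConjugate.eq_top_iff_eq_one (ENNReal.conjExponent (p e)) (p e)).1 h)
  have herr := tendsto_lintegral_translate_sum_div ENNReal.HolderConjugate.top_one
    ENNReal.one_ne_top hMemX hMemM (fun e => (inferInstance :
      (p e).HolderConjugate (ENNReal.conjExponent (p e)))) hconj hMemF hMemℓ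
  set err : ℝ → ℝ≥0∞ := fun h => (∫⁻ s, ∫⁻ σ in Ioo 0 h,
    (‖(Ioo 0 T).indicator (fun _ => (1 : ℝ)) s‖ₑ
        * ‖(Ioo 0 T).indicator X (s - σ) - (Ioo 0 T).indicator X s‖ₑ
      + ∑ e, ‖(Ioo 0 T).indicator (ℓ e) s‖ₑ
        * ‖(Ioo 0 T).indicator (fun t => flux hp hp_top (u t) e) (s - σ)
          - (Ioo 0 T).indicator (fun t => flux hp hp_top (u t) e) s‖ₑ)) / ENNReal.ofReal h
    with herrdef
  set rate : ℝ → ℝ := fun t => entropyRate n β γ w r (v t) (X t - y) with hrate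
  have hyi : IntegrableOn (fun t => X t - y) (Ioo 0 T) := hXi.sub (by simp)
  have hvm : AEStronglyMeasurable v (volume.restrict (Ioo 0 T)) :=
    (hv.mono Ioo_subset_Icc_self).aestronglyMeasurable measurableSet_Ioo
  have hri : IntegrableOn rate (Ioo 0 T) := hyi.norm.mono
    (aestronglyMeasurable_entropyRate hβ hγ hz n r hvm hyi.1)
    (ae_of_all _ fun t => by rw [norm_norm]; exact abs_entropyRate_le hβ hγ hz n hr _ _)
  have hrξ : IntegrableOn (fun t => rate t * ξ t) (Ioo 0 T) :=
    (hξ.integrable_mul hri).1.congr (ae_of_all _ fun t => mul_comm _ _)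
  have hmain : ∀ᶠ h in 𝓝[>] (0 : ℝ), (∫ s, ξ s * (g s - g (s - h))) / h
      ≤ (∫ t in Ioo 0 T, rate t * ξ t) + C * (err h).toReal := by
    -- For `h < c` the interval `[s - h, s]` stays in `]0, T[` whenever `ξ s ≠ 0`, so the extensions
    -- by zero are not felt. The bound `1` on the error only serves to make it finite.
    filter_upwards [Ioo_mem_nhdsGT hc, herr.eventually (gt_mem_nhds zero_lt_one)] with h hh he
    have hh0 : 0 < h := hh.1
    have hpt : ∀ᵐ s ∂(volume.restrict (Ioo 0 T)),
        ENNReal.ofReal (ξ s * (g s - g (s - h)) - h * (rate s * ξ s))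
        ≤ ENNReal.ofReal C * ∫⁻ σ in Ioo 0 h,
          (‖(Ioo 0 T).indicator (fun _ => (1 : ℝ)) s‖ₑ
            * ‖(Ioo 0 T).indicator X (s - σ) - (Ioo 0 T).indicator X s‖ₑ
          + ∑ e, ‖(Ioo 0 T).indicator (ℓ e) s‖ₑ
            * ‖(Ioo 0 T).indicator (fun t => flux hp hp_top (u t) e) (s - σ)
              - (Ioo 0 T).indicator (fun t => flux hp hp_top (u t) e) s‖ₑ) := by
      filter_upwards [hvu, ae_restrict_mem measurableSet_Ioo] with s hvs hs
      by_cases hsc : s ∈ Icc c d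
      · have hsh : ∀ σ ∈ Icc 0 h, s - σ ∈ Ioo 0 T := fun σ hσ =>
          ⟨by linarith [hσ.2, hh.2, hsc.1], by linarith [hσ.1, hs.2]⟩
        have hsh' := hsh h ⟨hh0.le, le_rfl⟩
        have hinterval : ∀ φ : G.Sobolev p, IntervalIntegrable
            (fun τ => sourceTerm (f τ) (ω τ) (u τ) φ) volume (s - h) s := fun φ =>
          intervalIntegrable_of_integrableOn_Ioo (by linarith)
            ((integrable_sourceTerm hp hp_top hf hω hu φ).mono_set
              (Ioo_subset_Ioo hsh'.1.le hs.2.le))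
        have hlem := ofReal_entropyFunctional_sub_le hp hp_top hE hβ hγ hβm hβγ hz hw hh0 hr
          hinterval (fun φ => heq φ _ (Ioo_subset_Icc_self hsh') _ (Ioo_subset_Icc_self hs)) hvs n
        have hfac : ξ s * (g s - g (s - h)) - h * (rate s * ξ s)
            = ξ s * (J (v s) - J (v (s - h)) - h * rate s) := by
          rw [hgv s hs, hgv _ hsh']; ring
        rw [hfac, ENNReal.ofReal_mul (hξ0 s)]
        refine mul_le_mul' (ENNReal.ofReal_le_ofReal ((le_abs_self _).trans (hC s)))
          (hlem.trans_eq ?_)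
        refine setLIntegral_congr_fun measurableSet_Ioo fun σ hσ => ?_
        have hσ' := hsh σ (Ioo_subset_Icc_self hσ)
        simp only [indicator_of_mem hσ', indicator_of_mem hs, enorm_one, one_mul, hℓ, hX]
      · rw [hout s hsc]
        simp
    have hi1 : IntegrableOn (fun s => ξ s * (g s - g (s - h))) (Ioo 0 T) :=
      ((hξ.smooth.continuous.mul (hg.sub (hg.comp (continuous_id.sub
        continuous_const)))).integrableOn_Icc (a := 0) (b := T)).mono_set Ioo_subset_Icc_self
    have hi2 := hrξ.const_mul h
    have hle : ∫⁻ s in Ioo 0 T,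
        ENNReal.ofReal (ξ s * (g s - g (s - h)) - h * (rate s * ξ s))
        ≤ ENNReal.ofReal C * (err h * ENNReal.ofReal h) := by
      refine (lintegral_mono_ae hpt).trans ?_
      rw [lintegral_const_mul' _ _ ENNReal.ofReal_ne_top]
      refine mul_le_mul_right (le_trans (setLIntegral_le_lintegral _ _) ?_) _
      rw [herrdef, ENNReal.div_mul_cancel (by simpa using hh0) ENNReal.ofReal_ne_top]
    have hfin : ENNReal.ofReal C * (err h * ENNReal.ofReal h) ≠ ∞ :=
      ENNReal.mul_ne_top ENNReal.ofReal_ne_top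
        (ENNReal.mul_ne_top (he.trans ENNReal.one_lt_top).ne ENNReal.ofReal_ne_top)
    have hreal := (integral_le_toReal_lintegral_ofReal (hi1.sub hi2)).trans
      (ENNReal.toReal_mono hfin hle)
    simp only [Pi.sub_apply] at hreal
    rw [integral_sub hi1 hi2, integral_const_mul, ENNReal.toReal_mul, ENNReal.toReal_mul,
      ENNReal.toReal_ofReal hC0, ENNReal.toReal_ofReal hh0.le,
      setIntegral_eq_integral_of_forall_compl_eq_zero
        fun s hs => by rw [hξ.eq_zero hs, zero_mul]] at hreal
    rw [div_le_iff₀ hh0]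
    linarith
  have hlim1 := tendsto_integral_sub_translate_div hξ hg
  have hlim2 : Tendsto (fun h => (∫ t in Ioo 0 T, rate t * ξ t) + C * (err h).toReal)
      (𝓝[>] (0 : ℝ)) (𝓝 ((∫ t in Ioo 0 T, rate t * ξ t) + C * 0)) :=
    (((ENNReal.tendsto_toReal ENNReal.zero_ne_top).comp herr).const_mul C).const_add _
  -- As `h → 0` the difference quotient moves onto `ξ` and the error disappears.
  have hfinal := le_of_tendsto_of_tendsto hlim1 hlim2 hmain
  rw [mul_zero, add_zero] at hfinal
  refine le_of_eq_of_le ?_ hfinal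
  have hext : ∫ s in Ioo 0 T, g s * deriv ξ s = ∫ s, g s * deriv ξ s :=
    setIntegral_eq_integral_of_forall_compl_eq_zero
      fun s hs => by rw [hξ.deriv_eq_zero hs, mul_zero]
  rw [← hext]
  congr 1
  exact setIntegral_congr_fun measurableSet_Ioo fun s hs => by simp only [hgv s hs]

end CompactMetricGraph

/-! ### From the entropies to the norm of the state space -/

namespace CompactMetricGraph

variable {V E : Type*} [Fintype V] [Fintype E] {G : CompactMetricGraph V E}
  {p : E → ℝ≥0∞} [∀ e, Fact (1 ≤ p e)] {β γ : E → ℝ → ℝ} {w : G.Sobolev p} {z : G.L1}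

/-- Since the vertex component of the base point is zero, the quotient in that component is exactly
`‖y.snd‖`. This is why the crude bound of the vertex term in `entropyRate` loses nothing. -/
theorem norm_stateSpace_quotient (v z : G.L1) (y : G.StateSpace) {r : ℝ} (hr : 0 < r) :
    (‖(WithLp.toLp 1 (v - z, 0) : G.StateSpace) + r • y‖
        - ‖(WithLp.toLp 1 (v - z, 0) : G.StateSpace)‖) / r
      = (‖v + r • y.fst - z‖ - ‖v - z‖) / r + ‖y.snd‖ := by
  rw [WithLp.prod_norm_eq_of_L1, WithLp.prod_norm_eq_of_L1]
  change (‖v - z + r • y.fst‖ + ‖(0 : G.VertexL1) + r • y.snd‖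
    - (‖v - z‖ + ‖(0 : G.VertexL1)‖)) / r = _
  rw [zero_add, norm_zero, add_zero, norm_smul r y.snd, Real.norm_of_nonneg hr.le]
  rw [sub_add_eq_add_sub v z]
  field_simp
  ring

theorem tendsto_entropyRate (hβ : ∀ e, Continuous (β e)) (hγ : ∀ e, Continuous (γ e))
    (hβm : ∀ e, StrictMono (β e)) (hβγ : ∀ e y, β e (γ e y) = y)
    (hz : ∀ e, z e =ᵐ[G.edgeMeasure e] fun x => γ e (Sobolev.fn w e x)) {r : ℝ} (hr : 0 < r)
    (v : G.L1) (y : G.StateSpace) :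
    Tendsto (fun n => entropyRate n β γ w r v y) atTop
      (𝓝 ((‖(WithLp.toLp 1 (v - z, 0) : G.StateSpace) + r • y‖
        - ‖(WithLp.toLp 1 (v - z, 0) : G.StateSpace)‖) / r)) := by
  rw [norm_stateSpace_quotient v z y hr]
  exact (((tendsto_entropyFunctional hβ hγ hβm hβγ hz _).sub
    (tendsto_entropyFunctional hβ hγ hβm hβγ hz _)).div_const r).add_const _

/-- Dominated convergence on the right-hand side, with the same majorant `‖(f, ω) - y‖ ξ` for both
limits. Keeping `r > 0` fixed while `n → ∞` avoids having to determine the limit of `S_n(u - w)`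
where `v = z`. -/
theorem neg_integral_norm_sub_le (hp : ∀ e, 1 < p e) (hp_top : ∀ e, p e < ∞)
    (hE : ∀ a, ∃ e, G.init e = a ∨ G.term e = a)
    (hβ : ∀ e, Continuous (β e)) (hγ : ∀ e, Continuous (γ e)) (hβm : ∀ e, StrictMono (β e))
    (hβγ : ∀ e y, β e (γ e y) = y)
    (hz : ∀ e, z e =ᵐ[G.edgeMeasure e] fun x => γ e (Sobolev.fn w e x)) {y : G.StateSpace}
    (hw : ∀ φ : G.Sobolev p, G.pLaplaceForm p w φ
      = G.pairing y.fst φ + ∑ a, y.snd a * Sobolev.vertexValue φ a)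
    {T : ℝ} (hT : 0 < T) {f v : ℝ → G.L1} {ω : ℝ → G.VertexL1} {u : ℝ → G.Sobolev p}
    (hf : IntegrableOn f (Ioo 0 T)) (hω : IntegrableOn ω (Ioo 0 T)) (hu : G.MemLpTime T u)
    (hv : ContinuousOn v (Icc 0 T))
    (hvu : ∀ᵐ t ∂(volume.restrict (Ioo 0 T)), ∀ e,
      v t e =ᵐ[G.edgeMeasure e] fun x => γ e (Sobolev.fn (u t) e x))
    (heq : ∀ φ : G.Sobolev p, ∀ s ∈ Icc 0 T, ∀ t ∈ Icc 0 T, G.pairing (v t - v s) φ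
      = ∫ τ in s..t, sourceTerm (f τ) (ω τ) (u τ) φ)
    {ξ : ℝ → ℝ} (hξ : IsScalarTest 0 T ξ) (hξ0 : ∀ t, 0 ≤ ξ t) :
    -∫ t in Ioo 0 T, ‖(WithLp.toLp 1 (v t - z, 0) : G.StateSpace)‖ * deriv ξ t
      ≤ ∫ t in Ioo 0 T, normBracket (WithLp.toLp 1 (v t - z, 0) : G.StateSpace)
          ((WithLp.toLp 1 (f t, ω t) : G.StateSpace) - y) * ξ t := by
  have hyi : IntegrableOn (fun t => (WithLp.toLp 1 (f t, ω t) : G.StateSpace) - y) (Ioo 0 T) :=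
    (integrable_stateSpace hf hω).sub (by simp)
  have hvm : AEStronglyMeasurable v (volume.restrict (Ioo 0 T)) :=
    (hv.mono Ioo_subset_Icc_self).aestronglyMeasurable measurableSet_Ioo
  have hxm : AEStronglyMeasurable (fun t => (WithLp.toLp 1 (v t - z, 0) : G.StateSpace))
      (volume.restrict (Ioo 0 T)) :=
    ((WithLp.prodContinuousLinearEquiv 1 ℝ G.L1 G.VertexL1).symm.continuous).comp_aestronglyMeasurable
      ((hvm.sub aestronglyMeasurable_const).prodMk aestronglyMeasurable_const)
  have hξm : AEStronglyMeasurable ξ (volume.restrict (Ioo 0 T)) :=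
    hξ.smooth.continuous.aestronglyMeasurable
  have hbound : IntegrableOn
      (fun t => ‖(WithLp.toLp 1 (f t, ω t) : G.StateSpace) - y‖ * ξ t) (Ioo 0 T) :=
    (hξ.integrable_mul hyi.norm).1.congr (ae_of_all _ fun t => mul_comm _ _)
  -- the limit `n → ∞`
  have hstep : ∀ r : ℝ, 0 < r →
      -∫ t in Ioo 0 T, ‖(WithLp.toLp 1 (v t - z, 0) : G.StateSpace)‖ * deriv ξ t
      ≤ ∫ t in Ioo 0 T, ((‖(WithLp.toLp 1 (v t - z, 0) : G.StateSpace)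
          + r • ((WithLp.toLp 1 (f t, ω t) : G.StateSpace) - y)‖
          - ‖(WithLp.toLp 1 (v t - z, 0) : G.StateSpace)‖) / r) * ξ t := fun r hr => by
    refine le_of_tendsto_of_tendsto' (b := (atTop : Filter ℕ)) (Tendsto.neg ?_) ?_ fun n =>
      neg_integral_entropyFunctional_le hp hp_top hE hβ hγ hβm hβγ hz hw hT hf hω hu hv hvu heq n
        hr hξ hξ0
    · have hvi : IntegrableOn (fun t => ‖v t - z‖) (Ioo 0 T) :=
        ((hv.sub continuousOn_const).norm.integrableOn_Icc).mono_set Ioo_subset_Icc_self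
      refine tendsto_integral_of_dominated_convergence (fun t => |deriv ξ t * ‖v t - z‖|)
        (fun n => ?_) (hξ.integrable_mul hvi).2.abs (fun n => ae_of_all _ fun t => ?_)
        (ae_of_all _ fun t => ?_)
      · exact ((continuous_entropyFunctional (continuous_smoothSign n) hβ hγ
          (abs_smoothSign_le_one n) hz).comp_aestronglyMeasurable hvm).mul
          hξ.continuous_deriv.aestronglyMeasurable
      · rw [norm_mul, abs_mul, abs_norm, mul_comm]
        exact mul_le_mul_of_nonneg_left (abs_entropyFunctional_le (continuous_smoothSign n) hβ hγ
          (abs_smoothSign_le_one n) hz _) (abs_nonneg _)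
      · have hnorm : ‖(WithLp.toLp 1 (v t - z, 0) : G.StateSpace)‖ = ‖v t - z‖ := by
          rw [WithLp.prod_norm_eq_of_L1]
          change ‖v t - z‖ + ‖(0 : G.VertexL1)‖ = _
          rw [norm_zero, add_zero]
        rw [hnorm]
        exact (tendsto_entropyFunctional hβ hγ hβm hβγ hz (v t)).mul_const _
    · refine tendsto_integral_of_dominated_convergence _
        (fun n => (aestronglyMeasurable_entropyRate hβ hγ hz n r hvm hyi.1).mul hξm) hbound
        (fun n => ae_of_all _ fun t => ?_) (ae_of_all _ fun t => ?_)
      · rw [norm_mul, Real.norm_of_nonneg (hξ0 t)]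
        exact mul_le_mul_of_nonneg_right (abs_entropyRate_le hβ hγ hz n hr _ _) (hξ0 t)
      · exact (tendsto_entropyRate hβ hγ hβm hβγ hz hr _ _).mul_const _
  -- the limit `r → 0`
  refine ge_of_tendsto (tendsto_integral_filter_of_dominated_convergence _
    (l := 𝓝[>] (0 : ℝ)) (F := fun r t => ((‖(WithLp.toLp 1 (v t - z, 0) : G.StateSpace)
          + r • ((WithLp.toLp 1 (f t, ω t) : G.StateSpace) - y)‖
          - ‖(WithLp.toLp 1 (v t - z, 0) : G.StateSpace)‖) / r) * ξ t)
    (Eventually.of_forall fun r => ?_) ?_ hbound (ae_of_all _ fun t =>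
      (tendsto_normBracket _ _).mul_const _)) (by
    filter_upwards [self_mem_nhdsWithin] with r hr using hstep r hr)
  · simp only [div_eq_mul_inv]
    exact (((hxm.add (hyi.1.const_smul r)).norm.sub hxm.norm).mul_const _).mul hξm
  · filter_upwards [self_mem_nhdsWithin] with r hr
    refine ae_of_all _ fun t => ?_
    rw [norm_mul, Real.norm_of_nonneg (hξ0 t)]
    exact mul_le_mul_of_nonneg_right (abs_norm_quotient_le _ _ hr) (hξ0 t)

end CompactMetricGraph

/-! ### Conclusion -/

theorem mainTheorem6 {V E : Type*} [Fintype V] [Fintype E] (G : CompactMetricGraph V E)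
    (hG : G.Connected)
    (p : E → ℝ≥0∞) [∀ e, Fact (1 ≤ p e)] (hp : ∀ e, 1 < p e) (hp_top : ∀ e, p e < ∞)
    (γ : E → ℝ → ℝ) (hγ_cont : ∀ e, Continuous (γ e)) (hγ_mono : ∀ e, StrictMono (γ e))
    (hγ_surj : ∀ e, Function.Surjective (γ e)) (hγ_zero : ∀ e, γ e 0 = 0)
    (v₀ : G.L1)
    (f : ℝ → G.L1) (hf : ∀ T : ℝ, 0 < T → IntegrableOn f (Ioo 0 T))
    (ω : ℝ → G.VertexL1) (hω : ∀ T : ℝ, 0 < T → IntegrableOn ω (Ioo 0 T))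
    (v : ℝ → G.L1) (hv : G.IsEvolutionWeakSolution p γ f ω v₀ v) :
    ∀ T : ℝ, 0 < T →
      IsIntegralSolution (G.graphOperator p γ)
        (fun t => (WithLp.toLp 1 (f t, ω t) : G.StateSpace))
        (WithLp.toLp 1 (v₀, 0)) T
        (fun t => WithLp.toLp 1 (v t, 0)) := by
  intro T hT
  have hcont : ContinuousOn (fun t => (WithLp.toLp 1 (v t, 0) : G.StateSpace)) (Icc 0 T) :=
    (WithLp.prodContinuousLinearEquiv 1 ℝ G.L1 G.VertexL1).symm.continuous.comp_continuousOn
      ((hv.continuousOn T hT).prodMk continuousOn_const)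
  have hFi := CompactMetricGraph.integrable_stateSpace (hf T hT) (hω T hT)
  have hconst : ∀ y : G.StateSpace, IntegrableOn (fun _ : ℝ => y) (Ioo 0 T) := fun y => by simp
  refine ⟨hcont, by rw [hv.initial], fun x y _ => ?_, fun x y hxy ξ hξ hξ0 => ?_⟩
  · refine IntegrableOn.locallyIntegrableOn (integrable_normBracket ?_ (hFi.sub (hconst y)))
    have := secondCountableTopologyEither_of_left ℝ G.StateSpace
    exact ((hcont.sub continuousOn_const).mono Ioo_subset_Icc_self).aestronglyMeasurable
      measurableSet_Ioo
  · obtain ⟨hx2, w, hz, hw⟩ := hxy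
    have hxeq : ∀ t, (WithLp.toLp 1 (v t, 0) : G.StateSpace) - x = WithLp.toLp 1 (v t - x.fst, 0) :=
      fun t => by
        refine (WithLp.ofLp_injective 1) (Prod.ext rfl ?_)
        change (0 : G.VertexL1) - x.snd = 0
        rw [show x.snd = 0 from hx2, sub_zero]
    simp only [hxeq]
    -- Without edges the space `L¹(G)` is trivial and vertex values are not determined, so this case
    -- is separate: the left-hand side vanishes and the bracket at `0` is nonnegative.
    rcases isEmpty_or_nonempty E with hEmpty | hne
    · have hzero : ∀ t, (WithLp.toLp 1 (v t - x.fst, 0) : G.StateSpace) = 0 := fun t => by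
        rw [Subsingleton.elim (v t - x.fst) 0]
        rfl
      simp only [hzero, norm_zero, zero_mul, integral_zero, neg_zero]
      exact integral_nonneg fun t => mul_nonneg (normBracket_zero_nonneg _) (hξ0 t)
    · obtain ⟨u, hu, hvu, heq⟩ := hv.equation T hT
      have hE := CompactMetricGraph.exists_edge_of_connected hG
      -- A strictly increasing surjection of `ℝ` is an order isomorphism, so its inverse is
      -- continuous.
      have hβ : ∀ e, ∃ β : ℝ → ℝ, Continuous β ∧ StrictMono β ∧ ∀ y, β (γ e y) = y := fun e =>
        let o := (hγ_mono e).orderIsoOfSurjective _ (hγ_surj e)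
        ⟨o.symm, o.symm.continuous, o.symm.strictMono, o.symm_apply_apply⟩
      choose β hβc hβm hβγ using hβ
      refine CompactMetricGraph.neg_integral_norm_sub_le hp hp_top hE hβc hγ_cont hβm hβγ hz
        (fun φ => ?_) hT (hf T hT) (hω T hT) hu (hv.continuousOn T hT) hvu
        (fun φ s hs t ht => CompactMetricGraph.pairing_sub_eq_integral hp hp_top hT (hf T hT)
          (hω T hT) hu (hv.continuousOn T hT) φ (CompactMetricGraph.hasWeakDeriv_pairing hp hp_top
            hE hT (hf T hT) (hω T hT) hu heq φ) hs ht) hξ hξ0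
      -- The term `∫_G z φ` occurs on both sides of the elliptic equation and cancels.
      have := hw φ
      rw [CompactMetricGraph.pairing_add] at this
      linarith
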